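/- Let $\omega=\{0,1,2,\dots\}$. A Borel equivalence relation is an equivalence relation $E$ on a Polish space $X$ that is a Borel subset of $X\times X$. For Borel equivalence relations $E$ on $X$ and $F$ on $Y$, write $E\le_B F$ if there is a Borel map $\theta:X\to Y$ such that $x\,E\,y\iff\theta(x)\,F\,\theta(y)$ for all $x,y\in X$. For $1\le r<\infty$, $\mathbb{R}^\omega/\ell_r$ denotes the equivalence relation on $\mathbb{R}^\omega$ in which $x$ and $y$ are equivalent iff $x-y\in\ell_r$, i.e. $\sum_n|x_n-y_n|^r<\infty$. For $U,V\subseteq\omega$, write $U\subseteq^*V$ if $U\setminus V$ is finite, and let $P(\omega)/\mathrm{Fin}$ be the set of subsets of $\omega$ modulo finite symmetric difference, partially ordered by $\subseteq^*$. Theorem. Let $1\le p<\infty$. There is a family $(E_U)_{U\subseteq\omega}$ of Borel equivalence relations such that (i) $\mathbb{R}^\omega/\ell_p\le_B E_U\le_B\mathbb{R}^\omega/\ell_q$ for every $U\subseteq\omega$ and every real $q>p$; (ii) $U\subseteq^*V\iff E_U\le_B E_V$ for all $U,V\subseteq\omega$. Consequently, $[U]\mapsto[E_U]$ is a well-defined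 order embedding of $P(\omega)/\mathrm{Fin}$ into the Borel equivalence relations taken up to mutual Borel reducibility and ordered by $\le_B$, and for every real $q>p$ all its values lie between the classes of $\mathbb{R}^\omega/\ell_p$ and $\mathbb{R}^\omega/\ell_q$. -/

import Mathlib

open scoped ENNReal

/-- A Borel equivalence relation: an equivalence relation `rel` on a Polish space `carrier`
which is a Borel subset of `carrier × carrier`. -/
structure BorelEqRel where
  carrier : Type
  [top : TopologicalSpace carrier]
  [polish : PolishSpace carrier]
  [meas : MeasurableSpace carrier]
  [borel : BorelSpace carrier]
  rel : Setoid carrier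
  borel_rel : MeasurableSet {z : carrier × carrier | rel z.1 z.2}

attribute [instance] BorelEqRel.top BorelEqRel.polish BorelEqRel.meas BorelEqRel.borel

namespace BorelEqRel

/-- `E` is Borel reducible to `F`. -/
def Reducible (E F : BorelEqRel) : Prop :=
  ∃ θ : E.carrier → F.carrier, Measurable θ ∧ ∀ x y, E.rel x y ↔ F.rel (θ x) (θ y)

/-- Borel equivalence relations are preordered by Borel reducibility `≤_B`. -/
instance : Preorder BorelEqRel where
  le := Reducible
  le_refl _ := ⟨id, measurable_id, fun _ _ => Iff.rfl⟩
  le_trans _ _ _ := fun ⟨θ, hθ, h⟩ ⟨η, hη, k⟩ =>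
    ⟨η ∘ θ, hη.comp hθ, fun x y => (h x y).trans (k _ _)⟩

end BorelEqRel

/-- Borel equivalence relations up to Borel bireducibility, ordered by `≤_B`. -/
abbrev BorelDegree : Type 1 := Antisymmetrization BorelEqRel (· ≤ ·)

/-- The bireducibility class of a Borel equivalence relation. -/
abbrev BorelEqRel.degree (E : BorelEqRel) : BorelDegree := toAntisymmetrization (· ≤ ·) E

theorem measurableSet_memℓp (p : ℝ≥0∞) :
    MeasurableSet {x : ℕ → ℝ | Memℓp (E := fun _ : ℕ => ℝ) x p} := by
  rcases p.trichotomy with rfl | rfl | hp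
  · have : {x : ℕ → ℝ | Memℓp (E := fun _ : ℕ => ℝ) x 0} =
        ⋃ N : ℕ, ⋂ n : ℕ, {x : ℕ → ℝ | N < n → x n = 0} := by
      ext x
      simp only [memℓp_zero_iff, Set.mem_ofPred_eq, Set.mem_iUnion, Set.mem_iInter]
      constructor
      · intro h
        obtain ⟨N, hN⟩ := h.bddAbove
        exact ⟨N, fun n hn => by_contra fun h0 => absurd (hN h0) (not_le.2 hn)⟩
      · rintro ⟨N, hN⟩
        exact (Set.finite_Iic N).subset fun n hn => not_lt.1 fun h => hn (hN n h)
    rw [this]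
    refine MeasurableSet.iUnion fun N => MeasurableSet.iInter fun n => ?_
    by_cases h : N < n
    · simpa [h] using measurableSet_eq_fun (measurable_pi_apply n) measurable_const
    · simp [h]
  · have : {x : ℕ → ℝ | Memℓp (E := fun _ : ℕ => ℝ) x ∞} =
        ⋃ N : ℕ, ⋂ n : ℕ, {x : ℕ → ℝ | ‖x n‖ ≤ N} := by
      ext x
      simp only [memℓp_infty_iff, Set.mem_ofPred_eq, Set.mem_iUnion, Set.mem_iInter]
      constructor
      · rintro ⟨C, hC⟩
        obtain ⟨N, hN⟩ := exists_nat_ge C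
        exact ⟨N, fun n => (hC ⟨n, rfl⟩).trans hN⟩
      · rintro ⟨N, hN⟩
        exact ⟨N, by rintro _ ⟨n, rfl⟩; exact hN n⟩
    rw [this]
    exact MeasurableSet.iUnion fun N => MeasurableSet.iInter fun n =>
      measurableSet_le (measurable_pi_apply n).norm measurable_const
  · have : {x : ℕ → ℝ | Memℓp (E := fun _ : ℕ => ℝ) x p} =
        ⋃ C : ℕ, ⋂ s : Finset ℕ, {x : ℕ → ℝ | ∑ i ∈ s, ‖x i‖ ^ p.toReal ≤ C} := by
      ext x
      simp only [memℓp_gen_iff'' hp, Set.mem_ofPred_eq, Set.mem_iUnion, Set.mem_iInter]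
      constructor
      · rintro ⟨C, -, hC⟩
        obtain ⟨N, hN⟩ := exists_nat_ge C
        exact ⟨N, fun s => (hC s).trans hN⟩
      · rintro ⟨N, hN⟩
        exact ⟨N, Nat.cast_nonneg N, hN⟩
    rw [this]
    exact MeasurableSet.iUnion fun N => MeasurableSet.iInter fun s =>
      measurableSet_le (by fun_prop) measurable_const

/-- The equivalence relation `ℝ^ω / ℓ_p` on `ℝ^ω` (with the product topology):
`x` and `y` are equivalent iff `x - y ∈ ℓ_p`. -/
def realModEll (p : ℝ≥0∞) : BorelEqRel where
  carrier := ℕ → ℝ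
  rel :=
    { r := fun x y => Memℓp (E := fun _ : ℕ => ℝ) (x - y) p
      iseqv :=
        { refl := fun x => by simpa using zero_memℓp
          symm := fun {x y} h => by simpa using h.neg
          trans := fun {x y z} h k => by simpa using h.add k } }
  borel_rel := (measurable_fst.sub measurable_snd) (measurableSet_memℓp p)

/-- The power set of `ω = ℕ`, preordered by almost inclusion `⊆*` below. -/
def PowOmega : Type := Set ℕ

/-- `U ⊆* V` iff `U \ V` is finite. -/
def AlmostSubset (U V : Set ℕ) : Prop := (U \ V).Finite

theorem AlmostSubset.refl (U : Set ℕ) : AlmostSubset U U := by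
  simp [AlmostSubset]

theorem AlmostSubset.trans {U V W : Set ℕ} (h : AlmostSubset U V) (k : AlmostSubset V W) :
    AlmostSubset U W :=
  (Set.Finite.union h k).subset fun n hn => by
    by_cases hV : n ∈ V
    · exact Or.inr ⟨hV, hn.2⟩
    · exact Or.inl ⟨hn.1, hV⟩

instance : Preorder PowOmega where
  le U V := AlmostSubset U V
  le_refl := AlmostSubset.refl
  le_trans _ _ _ := AlmostSubset.trans

/-- `P(ω)/Fin`, ordered by `⊆*`; two sets are identified iff each is almost included in the
other, that is, iff their symmetric difference is finite. -/
abbrev PowOmegaModFin : Type := Antisymmetrization PowOmega (· ≤ ·)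

/-- The class of `U ⊆ ω` in `P(ω)/Fin`. -/
abbrev modFin (U : Set ℕ) : PowOmegaModFin :=
  toAntisymmetrization (α := PowOmega) (· ≤ ·) U

/-!
For `U ⊆ ω` the relation `E_U` lives on `ℝ^ω`, whose coordinates are split into infinitely many rows
of infinitely many coordinates each. Two sequences are equivalent iff the sum over all coordinates of
a cost of the difference is finite. With `|s|` truncated at `1`, the cost is `|s| ^ p` in the rows
`t ∉ U` and `2 ^ (-t ^ 2) * |s| ^ p + |s| ^ (p + ε_t)` in the rows `t ∈ U` (`rowCost`, `setCost`),
where `ε_t → 0`. Each single row is equivalent to `ℓ_p`, but the constants grow with `t`. The exponents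
are adjusted such that `N_t ^ ε_t = 2 ^ t ^ 2`, where `N_t = gridSize t`: splitting an interval of
length `1` into `N_t` steps makes the cost of a step smaller by a factor of about
`2 ^ t ^ 2 * N_t ^ p`, whereas in the rows other than `t` the corresponding factor is at most about
`2 ^ (t - 1) ^ 2 * N_t ^ p` (`setCost_sub_le_sum`).

*Reductions.* Finitely many rows can be moved into row `0`, which gives `E_U ≤ E_V` for `U ⊆* V`
(`costEqRel_le_of_almostSubset`); row `0` alone gives `ℓ_p ≤ E_U`. For `q > p` all but finitely many
rows have exponents bounded away from `q`, and for `s < q` the map sending `x` to the sines and cosines of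
`2 ^ j * x` with amplitudes `2 ^ (-j * s / q)` embeds the line into `ℓ_q` such that the `q`-th power of
the distance is about `|x - y| ^ s`, with uniform constants (`tsum_snowflake_le`,
`le_tsum_snowflake`). Hence `E_U ≤ ℓ_q`.

*Non-reducibility.* Let `U \ V` be infinite and let `θ` reduce `E_U` to `E_V`. A Baire category
argument in the style of Dougherty and Hjorth (`exists_generic_point`, `exists_block_reduction`)
shows that on suitable coordinates, among them infinitely many of every row, `θ` acts
coordinatewise, with values in disjoint finite blocks. For `t ∈ U \ V` the path
`0, 1 / N_t, 2 / N_t, …, 1` in row `t` has much cheaper steps, compared with its endpoints, than is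
possible in `E_V`, in which row `t` carries the `p`-th power. So `θ` either raises the cost of some steps
or lowers the cost of the endpoints by factors that are unbounded in `t`; repeating coordinates
suitably often yields two sequences for which `θ` does not preserve finiteness of the cost
(`almostSubset_of_costEqRel_le`).
-/

open Filter Topology
open scoped NNReal

/-! ### Equivalence relations given by coordinatewise costs -/

/-- A family of cost functions on `ℝ`, one for each coordinate: `w n (x n - y n)` is the cost at
which the `n`-th coordinates of `x` and `y` differ. The quasi-triangle constant `K` is the same for
all coordinates, so that finiteness of the total cost is transitive. -/
structure IsCost (w : ℕ → ℝ → ℝ≥0∞) (K : ℝ≥0) : Prop where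
  measurable : ∀ n, Measurable (w n)
  zero : ∀ n, w n 0 = 0
  neg : ∀ n t, w n (-t) = w n t
  ne_top : ∀ n t, w n t ≠ ∞
  add_le : ∀ n s t, w n (s + t) ≤ K * (w n s + w n t)
  tendsto : ∀ n, Tendsto (w n) (𝓝 0) (𝓝 0)

namespace IsCost

variable {w : ℕ → ℝ → ℝ≥0∞} {K : ℝ≥0}

theorem sub_comm (hw : IsCost w K) (n : ℕ) (s t : ℝ) : w n (s - t) = w n (t - s) := by
  rw [← hw.neg, neg_sub]

theorem sub_le (hw : IsCost w K) (n : ℕ) (r s t : ℝ) :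
    w n (r - t) ≤ K * (w n (r - s) + w n (s - t)) := by
  simpa using hw.add_le n (r - s) (s - t)

theorem sum_sub_le (hw : IsCost w K) (J : Finset ℕ) (x y z : ℕ → ℝ) :
    ∑ n ∈ J, w n (x n - z n) ≤
      K * (∑ n ∈ J, w n (x n - y n) + ∑ n ∈ J, w n (y n - z n)) := by
  rw [← Finset.sum_add_distrib, Finset.mul_sum]
  exact Finset.sum_le_sum fun n _ => hw.sub_le n _ _ _

theorem tsum_sub_le (hw : IsCost w K) (x y z : ℕ → ℝ) :
    ∑' n, w n (x n - z n) ≤ K * (∑' n, w n (x n - y n) + ∑' n, w n (y n - z n)) := by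
  rw [← ENNReal.tsum_add, ← ENNReal.tsum_mul_left]
  exact ENNReal.tsum_le_tsum fun n => hw.sub_le n _ _ _

end IsCost

/-- The equivalence relation on `ℝ^ω` in which `x` and `y` are equivalent iff the total cost
`∑ₙ wₙ(xₙ - yₙ)` is finite. -/
def costEqRel (w : ℕ → ℝ → ℝ≥0∞) (K : ℝ≥0) (hw : IsCost w K) : BorelEqRel where
  carrier := ℕ → ℝ
  rel :=
    { r := fun x y => ∑' n, w n (x n - y n) ≠ ∞
      iseqv :=
        { refl := fun x => by simp [hw.zero]
          symm := fun {x y} h => by simpa only [hw.sub_comm _ (y _) (x _)] using h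
          trans := fun {x y z} h k =>
            ne_top_of_le_ne_top (ENNReal.mul_ne_top ENNReal.coe_ne_top (ENNReal.add_ne_top.2 ⟨h, k⟩))
              (hw.tsum_sub_le x y z) } }
  borel_rel := by
    have h : Measurable fun z : (ℕ → ℝ) × (ℕ → ℝ) => ∑' n, w n (z.1 n - z.2 n) :=
      Measurable.tsum fun n => (hw.measurable n).comp (by fun_prop)
    exact h (measurableSet_singleton ∞).compl

theorem realModEll_rel_iff {q : ℝ} (hq : 0 < q) (x y : ℕ → ℝ) :
    (realModEll (ENNReal.ofReal q)).rel x y ↔ ∑' n, ‖x n - y n‖ₑ ^ q ≠ ∞ := by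
  change Memℓp (E := fun _ : ℕ => ℝ) (x - y) (ENNReal.ofReal q) ↔ _
  have hq' : (ENNReal.ofReal q).toReal = q := ENNReal.toReal_ofReal hq.le
  rw [memℓp_gen_iff (by rwa [hq']), hq']
  have : ∀ n, ‖x n - y n‖ₑ ^ q = ENNReal.ofReal (‖(x - y) n‖ ^ q) := fun n => by
    rw [← ofReal_norm, ENNReal.ofReal_rpow_of_nonneg (norm_nonneg _) hq.le]; rfl
  simp only [this]
  refine ⟨fun h => h.tsum_ofReal_ne_top, fun h => ?_⟩
  have := ENNReal.summable_toReal h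
  refine this.congr fun n => ?_
  rw [ENNReal.toReal_ofReal (by positivity)]

/-- Comparison of series: only the terms below `1` matter, because a convergent series has only
finitely many others. -/
theorem tsum_ne_top_of_le_of_lt_one {ι : Type*} {f g : ι → ℝ≥0∞} {C : ℝ≥0∞} (hC : C ≠ ∞)
    (hg : ∀ i, g i ≠ ∞) (h : ∀ i, f i < 1 → g i ≤ C * f i) (hf : ∑' i, f i ≠ ∞) :
    ∑' i, g i ≠ ∞ := by
  classical
  have hfin := ENNReal.finite_const_le_of_tsum_ne_top hf one_ne_zero
  have hle : ∀ i, g i ≤ C * f i + if i ∈ hfin.toFinset then g i else 0 := fun i => by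
    by_cases hi : f i < 1
    · exact (h i hi).trans le_self_add
    · have : i ∈ hfin.toFinset := by simpa using hi
      simp [this]
  refine ne_top_of_le_ne_top ?_ (ENNReal.tsum_le_tsum hle)
  rw [ENNReal.tsum_add, ENNReal.tsum_mul_left]
  refine ENNReal.add_ne_top.2 ⟨ENNReal.mul_ne_top hC hf, ?_⟩
  rw [tsum_eq_sum (s := hfin.toFinset) fun i hi => by simp [hi]]
  refine (ENNReal.sum_lt_top.2 fun i hi => ?_).ne
  rw [if_pos hi]
  exact (hg i).lt_top

/-- Moving the coordinates along an injection. -/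
theorem tsum_extend_sub {w : ℕ → ℝ → ℝ≥0∞} (h0 : ∀ n, w n 0 = 0) {e : ℕ → ℕ}
    (he : e.Injective) (x y : ℕ → ℝ) :
    ∑' n, w n (Function.extend e x 0 n - Function.extend e y 0 n) =
      ∑' n, w (e n) (x n - y n) := by
  rw [← tsum_extend_zero he fun n => w (e n) (x n - y n)]
  congr 1 with n
  by_cases hn : ∃ m, e m = n
  · obtain ⟨m, rfl⟩ := hn
    simp [he.extend_apply]
  · simp [Function.extend_apply' _ _ _ hn, h0]

theorem measurable_extend_zero {e : ℕ → ℕ} (he : e.Injective) :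
    Measurable fun x : ℕ → ℝ => Function.extend e x 0 := by
  refine measurable_pi_lambda _ fun n => ?_
  by_cases hn : ∃ m, e m = n
  · obtain ⟨m, rfl⟩ := hn
    simpa [he.extend_apply] using measurable_pi_apply m
  · simp [Function.extend_apply' _ _ _ hn]

/-! ### Baire category -/

/-- Countably many Borel sets become relatively open on a countable intersection of dense open
sets. -/
theorem exists_dense_open_of_measurableSet {X ι : Type*} [TopologicalSpace X] [MeasurableSpace X]
    [BorelSpace X] [Countable ι] (B : ι → Set X) (hB : ∀ i, MeasurableSet (B i)) :
    ∃ O : ℕ → Set X, (∀ n, IsOpen (O n) ∧ Dense (O n)) ∧ ∃ U : ι → Set X, (∀ i, IsOpen (U i)) ∧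
      ∀ x, (∀ n, x ∈ O n) → ∀ i, x ∈ B i ↔ x ∈ U i := by
  choose U hU hBU using fun i => (hB i).residualEq_isOpen
  have h : {x | ∀ i, x ∈ B i ↔ x ∈ U i} ∈ residual X := by
    have : ∀ᶠ x in residual X, ∀ i, x ∈ B i ↔ x ∈ U i :=
      eventually_countable_forall.2 fun i => (hBU i).mem_iff
    exact this
  obtain ⟨S, hSo, hSd, hSc, hS⟩ := mem_residual_iff.1 h
  obtain ⟨O, hO⟩ := (hSc.insert Set.univ).exists_eq_range (Set.insert_nonempty _ _)
  have hmem : ∀ n, O n = Set.univ ∨ O n ∈ S := fun n => by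
    have : O n ∈ insert Set.univ S := hO ▸ Set.mem_range_self n
    simpa using this
  refine ⟨O, fun n => ?_, U, hU, fun x hx => hS fun t ht => ?_⟩
  · rcases hmem n with h | h
    · rw [h]; exact ⟨isOpen_univ, dense_univ⟩
    · exact ⟨hSo _ h, hSd _ h⟩
  · have : t ∈ Set.range O := hO ▸ Set.mem_insert_of_mem _ ht
    obtain ⟨n, rfl⟩ := this
    exact hx n

/-- The sequence `x` with its first `L` entries replaced by those of `r`. -/
def splice {L : ℕ} (r : Fin L → ℕ) (x : ℕ → ℕ) (i : ℕ) : ℕ :=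
  if h : i < L then r ⟨i, h⟩ else x i

theorem splice_of_lt {L : ℕ} {r : Fin L → ℕ} {x : ℕ → ℕ} {i : ℕ} (h : i < L) :
    splice r x i = r ⟨i, h⟩ := dif_pos h

theorem splice_of_le {L : ℕ} {r : Fin L → ℕ} {x : ℕ → ℕ} {i : ℕ} (h : L ≤ i) :
    splice r x i = x i := dif_neg h.not_gt

theorem continuous_splice {L : ℕ} (r : Fin L → ℕ) : Continuous (splice r) := by
  refine continuous_pi fun i => ?_
  by_cases h : i < L
  · simp only [splice_of_lt h]; fun_prop
  · simp only [splice_of_le (not_lt.1 h)]; fun_prop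

theorem eventually_forall_mem_of_isOpen {U : Set (ℕ → ℕ)} (hU : IsOpen U) {x : ℕ → ℕ}
    (hx : x ∈ U) : ∀ᶠ n in atTop, ∀ y : ℕ → ℕ, (∀ i < n, y i = x i) → y ∈ U := by
  obtain ⟨I, u, hu, hI⟩ := isOpen_pi_iff.1 hU x hx
  filter_upwards [eventually_gt_atTop (I.sup id)] with n hn y hy
  refine hI fun i hi => ?_
  rw [hy i ((Finset.le_sup (f := id) hi).trans_lt hn)]
  exact (hu i hi).2

theorem isOpenMap_splice {L : ℕ} (r : Fin L → ℕ) : IsOpenMap (splice r) := by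
  intro U hU
  rw [isOpen_iff_mem_nhds]
  rintro _ ⟨x, hx, rfl⟩
  obtain ⟨n, hn⟩ := (eventually_forall_mem_of_isOpen hU hx).exists
  have hopen : IsOpen {y : ℕ → ℕ | ∀ i ∈ Finset.range (n + L), y i = splice r x i} := by
    simp only [Set.ofPred_forall]
    exact isOpen_biInter_finset fun i _ =>
      (isOpen_discrete ({splice r x i} : Set ℕ)).preimage (continuous_apply (A := fun _ => ℕ) i)
  refine mem_of_superset (hopen.mem_nhds fun i _ => rfl) fun y hy => ?_
  simp only [Finset.mem_range, Set.mem_ofPred_eq] at hy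
  refine ⟨fun i => if i < L then x i else y i, hn _ fun i hi => ?_, ?_⟩
  · by_cases h : i < L
    · simp [h]
    · simp [h, hy i (by omega), splice_of_le (not_lt.1 h)]
  · funext i
    by_cases h : i < L
    · rw [splice_of_lt h, hy i (by omega), splice_of_lt h]
    · simp [splice_of_le (not_lt.1 h), h]

/-- The intersection of the sets `O n` contains a point that stays in it under all changes of
finitely many entries. -/
theorem exists_forall_splice_mem {O : ℕ → Set (ℕ → ℕ)} (hO : ∀ n, IsOpen (O n) ∧ Dense (O n)) :
    ∃ z, ∀ (L : ℕ) (r : Fin L → ℕ) (n : ℕ), splice r z ∈ O n := by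
  have : Dense (⋂ q : (Σ L, Fin L → ℕ) × ℕ, splice q.1.2 ⁻¹' O q.2) :=
    dense_iInter_of_isOpen (fun q => (hO _).1.preimage (continuous_splice _))
      fun q => (hO _).2.preimage (isOpenMap_splice _)
  obtain ⟨z, hz⟩ := this.nonempty
  exact ⟨z, fun L r n => Set.mem_iInter.1 hz (⟨L, r⟩, n)⟩

/-! ### Reductions that act on blocks of coordinates -/

theorem IsCost.exists_rat_le {w : ℕ → ℝ → ℝ≥0∞} {K : ℝ≥0} (hw : IsCost w K) (n : ℕ) (t : ℝ)
    {ε : ℝ≥0∞} (hε : 0 < ε) : ∃ ρ : ℚ, w n (t - ρ) ≤ ε := by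
  have h : Tendsto (fun s : ℝ => w n (t - s)) (𝓝 t) (𝓝 0) := by
    refine (hw.tendsto n).comp ?_
    have : Tendsto (fun s : ℝ => t - s) (𝓝 t) (𝓝 (t - t)) := by
      exact (continuous_const.sub continuous_id).tendsto t
    simpa using this
  obtain ⟨ρ, hρ⟩ := Rat.denseRange_cast.exists_mem_open isOpen_interior
    ⟨t, mem_interior_iff_mem_nhds.2 (h.eventually (Iic_mem_nhds hε))⟩
  have := interior_subset hρ
  exact ⟨ρ, this⟩

/-- For a Borel map `θ` that sends sequences with finitely many differences to sequences at finite
cost, a generic point `z` has the following property. For every `L` there are `l < L'` such that,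
for generic points `y` that agree with `z` on `[L, L')` and whose entries below `L` obey the bound
`max (B i) (z i)` (a bound that admits both `z` and the sequences bounded by `B`), changing the
entries below `L` affects the coordinates of `θ y` from `l` on only by a small cost, and
the entries from `L'` on affect the coordinates below `l` only by small costs. -/
theorem exists_generic_point {w : ℕ → ℝ → ℝ≥0∞} {K : ℝ≥0} (hw : IsCost w K)
    {θ : (ℕ → ℕ) → ℕ → ℝ} (hθ : Measurable θ)
    (hfin : ∀ (L : ℕ) (r : Fin L → ℕ) (x : ℕ → ℕ),
      ∑' c, w c (θ x c - θ (splice r x) c) ≠ ∞) (B : ℕ → ℕ) :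
    ∃ (z : ℕ → ℕ) (O : ℕ → Set (ℕ → ℕ)), ∀ L, ∃ l L', L < l ∧ l < L' ∧
      ∀ r : Fin L → ℕ, (∀ i, r i ≤ max (B i) (z i)) →
        (∀ y, (∀ i < L', y i = splice r z i) → ∀ n ≤ L, y ∈ O n) ∧
        (∀ y, (∀ i < L', y i = splice r z i) → (∀ n, y ∈ O n) →
          ∀ r' : Fin L → ℕ, (∀ i, r' i ≤ max (B i) (z i)) →
            ∑' c, w (c + l) (θ y (c + l) - θ (splice r' y) (c + l)) ≤ 2⁻¹ ^ L) ∧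
        (∀ y y', (∀ i < L', y i = splice r z i) → (∀ i < L', y' i = splice r z i) →
          (∀ n, y ∈ O n) → (∀ n, y' ∈ O n) →
          ∀ c < l, w c (θ y c - θ y' c) ≤ K * (2⁻¹ ^ (L + c) + 2⁻¹ ^ (L + c))) := by
  have hpos : ∀ n : ℕ, (0 : ℝ≥0∞) < 2⁻¹ ^ n := fun n => by simp [pos_iff_ne_zero]
  have hθc : ∀ c, Measurable fun x => θ x c := fun c => measurable_pi_iff.1 hθ c
  have hwm : ∀ n, Measurable (w n) := hw.measurable
  -- The Borel sets on which the two smallness conditions hold become relatively open.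
  obtain ⟨O, hO, U, hU, hBU⟩ := exists_dense_open_of_measurableSet
    (ι := ((Σ L, Fin L → ℕ) × ℕ) ⊕ (ℕ × ℚ × ℕ))
    (fun q : ((Σ L, Fin L → ℕ) × ℕ) ⊕ (ℕ × ℚ × ℕ) => match q with
      | .inl q => {y | ∑' c, w (c + q.2) (θ y (c + q.2) - θ (splice q.1.2 y) (c + q.2)) ≤
          2⁻¹ ^ q.1.1}
      | .inr q => {y | w q.1 (θ y q.1 - q.2.1) ≤ 2⁻¹ ^ q.2.2})
    (by
      rintro (q | q)
      · refine measurableSet_le (Measurable.tsum fun c => (hwm _).comp ?_) measurable_const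
        exact (hθc _).sub ((hθc _).comp (continuous_splice q.1.2).measurable)
      · exact measurableSet_le ((hwm _).comp ((hθc _).sub measurable_const)) measurable_const)
  obtain ⟨z, hz⟩ := exists_forall_splice_mem hO
  refine ⟨z, O, fun L => ?_⟩
  have hQ : {r : Fin L → ℕ | ∀ i, r i ≤ max (B i) (z i)}.Finite :=
    Set.finite_Iic fun i : Fin L => max (B i) (z i)
  have h1 : ∀ᶠ l in atTop, ∀ r ∈ {r : Fin L → ℕ | ∀ i, r i ≤ max (B i) (z i)},
      ∀ r' ∈ {r : Fin L → ℕ | ∀ i, r i ≤ max (B i) (z i)},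
      ∑' c, w (c + l) (θ (splice r z) (c + l) - θ (splice r' (splice r z)) (c + l)) ≤
        2⁻¹ ^ L := by
    simp only [hQ.eventually_all]
    intro r _ r' _
    exact (ENNReal.tendsto_sum_nat_add _ (hfin L r' (splice r z))).eventually (Iic_mem_nhds (hpos L))
  obtain ⟨l, hl, hLl⟩ := (h1.and (eventually_gt_atTop L)).exists
  choose ρ hρ using fun (x : ℕ → ℕ) (c : ℕ) => hw.exists_rat_le c (θ x c) (hpos (L + c))
  have h2 : ∀ᶠ L' in atTop, ∀ r ∈ {r : Fin L → ℕ | ∀ i, r i ≤ max (B i) (z i)},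
      (∀ n ∈ Set.Iic L, ∀ y : ℕ → ℕ, (∀ i < L', y i = splice r z i) → y ∈ O n) ∧
      (∀ r' ∈ {r : Fin L → ℕ | ∀ i, r i ≤ max (B i) (z i)}, ∀ y : ℕ → ℕ,
        (∀ i < L', y i = splice r z i) → y ∈ U (.inl (⟨L, r'⟩, l))) ∧
      (∀ c ∈ Set.Iio l, ∀ y : ℕ → ℕ,
        (∀ i < L', y i = splice r z i) → y ∈ U (.inr (c, ρ (splice r z) c, L + c))) := by
    simp only [hQ.eventually_all, eventually_and, (Set.finite_Iic L).eventually_all,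
      (Set.finite_Iio l).eventually_all]
    refine fun r hr => ⟨fun n _ => eventually_forall_mem_of_isOpen (hO n).1 (hz L r n),
      fun r' hr' => eventually_forall_mem_of_isOpen (hU _) ?_,
      fun c _ => eventually_forall_mem_of_isOpen (hU _) ?_⟩
    · exact (hBU _ (hz L r) (.inl (⟨L, r'⟩, l))).1 (hl r hr r' hr')
    · exact (hBU _ (hz L r) (.inr (c, ρ (splice r z) c, L + c))).1 (hρ _ c)
  obtain ⟨L', h, hL'⟩ := (h2.and (eventually_gt_atTop l)).exists
  refine ⟨l, L', hLl, hL', fun r hr => ⟨fun y hy n hn => (h r hr).1 n hn y hy,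
    fun y hy hyO r' hr' => ?_, fun y y' hy hy' hyO hyO' c hc => ?_⟩⟩
  · exact (hBU y hyO (.inl (⟨L, r'⟩, l))).2 ((h r hr).2.1 r' hr' y hy)
  · have e := (hBU y hyO (.inr (c, ρ (splice r z) c, L + c))).2 ((h r hr).2.2 c hc y hy)
    have e' := (hBU y' hyO' (.inr (c, ρ (splice r z) c, L + c))).2 ((h r hr).2.2 c hc y' hy')
    refine (hw.sub_le c _ (ρ (splice r z) c : ℝ) _).trans ?_
    rw [hw.sub_comm c (ρ (splice r z) c : ℝ)]
    exact mul_le_mul_right (add_le_add e e') _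

theorem tsum_eq_sum_add_tsum_sum_Ico (F : ℕ → ℝ≥0∞) {l : ℕ → ℕ} (hl : StrictMono l) :
    ∑' c, F c = ∑ c ∈ Finset.range (l 0), F c +
      ∑' j, ∑ c ∈ Finset.Ico (l j) (l (j + 1)), F c := by
  have h : ∀ n, ∑ c ∈ Finset.range (l n), F c = ∑ c ∈ Finset.range (l 0), F c +
      ∑ j ∈ Finset.range n, ∑ c ∈ Finset.Ico (l j) (l (j + 1)), F c := fun n => by
    induction n with
    | zero => simp
    | succ n ih =>
      rw [Finset.sum_range_succ, ← add_assoc, ← ih, Finset.sum_range_add_sum_Ico]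
      exact (hl n.lt_succ_self).le
  rw [ENNReal.tsum_eq_iSup_nat' hl.tendsto_atTop, ENNReal.tsum_eq_iSup_nat, ENNReal.add_iSup]
  exact iSup_congr h

theorem tsum_ne_top_of_le_mul_add {F D e : ℕ → ℝ≥0∞} {C : ℝ≥0∞} (hC : C ≠ ∞)
    (he : ∑' j, e j ≠ ∞) (h : ∀ j, F j ≤ C * (D j + e j)) (hD : ∑' j, D j ≠ ∞) :
    ∑' j, F j ≠ ∞ := by
  refine ne_top_of_le_ne_top ?_ (ENNReal.tsum_le_tsum h)
  rw [ENNReal.tsum_mul_left, ENNReal.tsum_add]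
  exact ENNReal.mul_ne_top hC (ENNReal.add_ne_top.2 ⟨hD, he⟩)

/-- A Borel reduction of a relation given by coordinatewise costs `a` to one given by costs `w` can
be made to act separately on infinitely many coordinates: after restriction to suitable coordinates
`k j`, found in prescribed infinite sets `S j`, it becomes the sequence of maps `T j` with values in
disjoint finite blocks `J j` of coordinates. -/
theorem exists_block_reduction {a : ℕ → ℕ → ℕ → ℝ≥0∞} (ha0 : ∀ i u, a i u u = 0)
    (hafin : ∀ i u v, a i u v ≠ ∞) {w : ℕ → ℝ → ℝ≥0∞} {K : ℝ≥0} (hw : IsCost w K)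
    {θ : (ℕ → ℕ) → ℕ → ℝ} (hθ : Measurable θ)
    (hred : ∀ x y, ∑' i, a i (x i) (y i) ≠ ∞ ↔ ∑' c, w c (θ x c - θ y c) ≠ ∞)
    (B : ℕ → ℕ) {S : ℕ → Set ℕ} (hS : ∀ j, (S j).Infinite) :
    ∃ k : ℕ → ℕ, (∀ j, k j ∈ S j) ∧ ∃ (J : ℕ → Finset ℕ) (T : ℕ → ℕ → ℕ → ℝ),
      ∀ u v : ℕ → ℕ, (∀ j, u j ≤ B (k j)) → (∀ j, v j ≤ B (k j)) →
        (∑' j, a (k j) (u j) (v j) ≠ ∞ ↔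
          ∑' j, ∑ c ∈ J j, w c (T j (u j) c - T j (v j) c) ≠ ∞) := by
  have hfin : ∀ (L : ℕ) (r : Fin L → ℕ) (x : ℕ → ℕ),
      ∑' c, w c (θ x c - θ (splice r x) c) ≠ ∞ := by
    intro L r x
    rw [← hred, tsum_eq_sum (s := Finset.range L) fun i hi => ?_]
    · exact (ENNReal.sum_lt_top.2 fun i _ => (hafin _ _ _).lt_top).ne
    · rw [splice_of_le (by simpa using hi), ha0]
  obtain ⟨z, O, hz⟩ := exists_generic_point hw hθ hfin B
  choose h g hh hg H using hz
  choose pick hpick hpick' using fun j m => (hS j).exists_gt m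
  -- The positions: `κ (j + 1)` lies beyond the stage reached after `κ j`.
  -- The first one serves only as a start: the entry there is never changed.
  let κ : ℕ → ℕ := fun j => Nat.rec 0 (fun j kj => pick j (g (kj + 1))) j
  have hκ : ∀ j, g (κ j + 1) < κ (j + 1) := fun j => hpick' j _
  have hκmono : StrictMono κ := strictMono_nat_of_lt_succ fun j => by
    have := hκ j; have := hh (κ j + 1); have := hg (κ j + 1); omega
  have hκle : ∀ j, j ≤ κ j := hκmono.id_le
  let κ' : ℕ → ℕ := fun j => κ (j + 1)
  have hκ' : κ'.Injective := fun i j hij => Nat.succ_injective (hκmono.injective hij)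
  let l : ℕ → ℕ := fun j => h (κ j + 1)
  have hl : StrictMono l := strictMono_nat_of_lt_succ fun j => by
    have := hκ j; have := hg (κ j + 1); have := hh (κ (j + 1) + 1)
    change h (κ j + 1) < h (κ (j + 1) + 1); omega
  -- Valid points: bounded, and equal to `z` off the chosen positions.
  let V : (ℕ → ℕ) → Prop := fun y => (∀ i, y i ≤ max (B i) (z i)) ∧ ∀ i, (∀ j, κ' j ≠ i) → y i = z i
  have hoff : ∀ y, V y → ∀ j i, κ j < i → i < κ (j + 1) → y i = z i := by
    refine fun y hy j i h1 h2 => hy.2 i fun m hm => ?_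
    subst hm
    have h3 : j < m + 1 := hκmono.lt_iff_lt.1 h1
    have h4 : m + 1 < j + 1 := hκmono.lt_iff_lt.1 h2
    omega
  have hagree : ∀ y, V y → ∀ j, ∀ i < g (κ j + 1),
      y i = splice (L := κ j + 1) (fun i => y i) z i := by
    intro y hy j i hi
    by_cases h1 : i < κ j + 1
    · rw [splice_of_lt h1]
    · rw [splice_of_le (not_lt.1 h1)]
      exact hoff y hy j i (by omega) (hi.trans (hκ j))
  have hgen : ∀ y, V y → ∀ n, y ∈ O n := fun y hy n =>
    (H (κ n + 1) (fun i => y i) fun i => hy.1 i).1 y (hagree y hy n) n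
      ((hκle n).trans (Nat.le_succ _))
  let J : ℕ → Finset ℕ := fun j => Finset.Ico (l j) (l (j + 1))
  let T : ℕ → ℕ → ℕ → ℝ := fun j u => θ (Function.update z (κ' j) u)
  -- In the block `J j`, the image of a valid point depends on its entry at `κ' j` up to a small cost.
  let e : ℕ → ℝ≥0∞ := fun j => K * (2⁻¹ ^ j + ∑ c ∈ J j, (K : ℝ≥0∞) * (2⁻¹ ^ (j + c) + 2⁻¹ ^ (j + c)))
  have hhalf : ∀ {m n : ℕ}, m ≤ n → (2⁻¹ : ℝ≥0∞) ^ n ≤ 2⁻¹ ^ m := fun hmn =>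
    pow_le_pow_right_of_le_one' (by simp) hmn
  have happrox : ∀ y, V y → ∀ j,
      ∑ c ∈ J j, w c (θ y c - T j (y (κ' j)) c) ≤ e j := by
    intro y hy j
    -- First change the entries of `y` up to `κ j` to those of `z`, then the ones beyond `κ' j`.
    let r : Fin (κ j + 1) → ℕ := fun i => z i
    have hr : ∀ i, r i ≤ max (B i) (z i) := fun i => le_max_right _ _
    have hm : V (splice r y) := by
      refine ⟨fun i => ?_, fun i hi => ?_⟩
      · by_cases h1 : i < κ j + 1
        · rw [splice_of_lt h1]; exact le_max_right _ _
        · rw [splice_of_le (not_lt.1 h1)]; exact hy.1 i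
      · by_cases h1 : i < κ j + 1
        · rw [splice_of_lt h1]
        · rw [splice_of_le (not_lt.1 h1)]; exact hy.2 i hi
    have hu : V (Function.update z (κ' j) (y (κ' j))) := by
      refine ⟨fun i => ?_, fun i hi => Function.update_of_ne (hi j).symm _ _⟩
      by_cases h1 : i = κ' j
      · subst h1; simpa using hy.1 _
      · rw [Function.update_of_ne h1]; exact le_max_right _ _
    have hmu : ∀ i, i < κ (j + 1) + 1 → splice r y i = Function.update z (κ' j) (y (κ' j)) i := by
      intro i hi
      by_cases h1 : i = κ' j
      · subst h1
        rw [Function.update_self, splice_of_le]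
        exact hκmono j.lt_succ_self
      · rw [Function.update_of_ne h1]
        by_cases h2 : i < κ j + 1
        · rw [splice_of_lt h2]
        · rw [splice_of_le (not_lt.1 h2)]
          have : κ' j = κ (j + 1) := rfl
          exact hoff y hy j i (by omega) (by omega)
    refine (hw.sum_sub_le (J j) (θ y) (θ (splice r y)) _).trans
      (mul_le_mul_right (add_le_add ?_ (Finset.sum_le_sum fun c hc => ?_)) _)
    · have h1 := (H (κ j + 1) (fun i => y i) fun i => hy.1 i).2.1 y (hagree y hy j) (hgen y hy) r hr
      refine (le_trans ?_ h1).trans (hhalf (show j ≤ κ j + 1 from (hκle j).trans (Nat.le_succ _)))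
      rw [Finset.sum_Ico_eq_sum_range]
      simp only [add_comm (l j)]
      exact ENNReal.sum_le_tsum (f := fun c => w (c + l j) (θ y (c + l j) - θ (splice r y) (c + l j))) _
    · have h2 := (H (κ (j + 1) + 1) (fun i => splice r y i) fun i => hm.1 i).2.2 (splice r y)
        (Function.update z (κ' j) (y (κ' j))) (hagree _ hm (j + 1)) (fun i hi => ?_)
        (hgen _ hm) (hgen _ hu) c (Finset.mem_Ico.1 hc).2
      · refine h2.trans (mul_le_mul_right ?_ _)
        have : j + c ≤ κ (j + 1) + 1 + c := by have := hκle (j + 1); omega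
        exact add_le_add (hhalf this) (hhalf this)
      · rw [hagree _ hu (j + 1) i hi]
        by_cases h1 : i < κ (j + 1) + 1
        · rw [splice_of_lt h1, splice_of_lt h1, hmu i h1]
        · rw [splice_of_le (not_lt.1 h1), splice_of_le (not_lt.1 h1)]
  have hgeom : ∑' n : ℕ, (2⁻¹ : ℝ≥0∞) ^ n ≠ ∞ := by
    rw [ENNReal.tsum_geometric]; simp
  have he : ∑' j, e j ≠ ∞ := by
    have hsum : ∀ j, ∑ c ∈ J j, (K : ℝ≥0∞) * (2⁻¹ ^ (j + c) + 2⁻¹ ^ (j + c)) ≤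
        2⁻¹ ^ j * (K * (2 * ∑' n : ℕ, 2⁻¹ ^ n)) := fun j => by
      refine (ENNReal.sum_le_tsum _).trans_eq ?_
      rw [← ENNReal.tsum_mul_left, ← ENNReal.tsum_mul_left, ← ENNReal.tsum_mul_left]
      congr 1 with c
      rw [pow_add]; ring
    refine ne_top_of_le_ne_top ?_
      (ENNReal.tsum_le_tsum fun j => mul_le_mul_right (add_le_add le_rfl (hsum j)) _)
    rw [ENNReal.tsum_mul_left, ENNReal.tsum_add, ENNReal.tsum_mul_right]
    finiteness
  refine ⟨κ', fun j => hpick j _, J, T, fun u v hu hv => ?_⟩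
  let fill : (ℕ → ℕ) → ℕ → ℕ := fun u => Function.extend κ' u z
  have hfill : ∀ u j, fill u (κ' j) = u j := fun u j => hκ'.extend_apply u z j
  have hfill' : ∀ u i, (∀ j, κ' j ≠ i) → fill u i = z i := fun u i hi =>
    Function.extend_apply' _ _ _ (by simpa using hi)
  have hV : ∀ u, (∀ j, u j ≤ B (κ' j)) → V (fill u) := by
    refine fun u hu => ⟨fun i => ?_, fun i hi => hfill' u i hi⟩
    by_cases hi : ∃ j, κ' j = i
    · obtain ⟨j, rfl⟩ := hi
      rw [hfill]; exact (hu j).trans (le_max_left _ _)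
    · rw [hfill' u i (by simpa using hi)]; exact le_max_right _ _
  have hsource : ∑' j, a (κ' j) (u j) (v j) = ∑' i, a i (fill u i) (fill v i) := by
    rw [← tsum_extend_zero hκ' fun j => a (κ' j) (u j) (v j)]
    congr 1 with i
    by_cases hi : ∃ j, κ' j = i
    · obtain ⟨j, rfl⟩ := hi
      rw [hκ'.extend_apply, hfill, hfill]
    · rw [Function.extend_apply' _ _ _ hi, hfill' u i (by simpa using hi),
        hfill' v i (by simpa using hi), ha0]; rfl
  rw [hsource, hred, tsum_eq_sum_add_tsum_sum_Ico _ hl]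
  have hhead : ∑ c ∈ Finset.range (l 0), w c (θ (fill u) c - θ (fill v) c) ≠ ∞ :=
    (ENNReal.sum_lt_top.2 fun c _ => (hw.ne_top _ _).lt_top).ne
  have hKtop : (K : ℝ≥0∞) ≠ ∞ := ENNReal.coe_ne_top
  have hu' := happrox _ (hV u hu)
  have hv' := happrox _ (hV v hv)
  simp only [hfill] at hu' hv'
  have hue : ∑' j, (e j + K * e j) ≠ ∞ := by
    rw [ENNReal.tsum_add, ENNReal.tsum_mul_left (f := e)]
    exact ENNReal.add_ne_top.2 ⟨he, ENNReal.mul_ne_top hKtop he⟩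
  -- Both comparisons pass through two intermediate points.
  have hchain : ∀ (j : ℕ) (x x' y' y : ℕ → ℝ), ∑ c ∈ J j, w c (x c - x' c) ≤ e j →
      ∑ c ∈ J j, w c (y c - y' c) ≤ e j → ∑ c ∈ J j, w c (x c - y c) ≤
        (K + K * K) * (∑ c ∈ J j, w c (x' c - y' c) + (e j + K * e j)) := by
    intro j x x' y' y hx hy
    have h1 := hw.sum_sub_le (J j) x x' y
    have h2 := hw.sum_sub_le (J j) x' y' y
    simp only [hw.sub_comm _ (y' _) (y _)] at h2
    calc _ ≤ K * (e j + K * (∑ c ∈ J j, w c (x' c - y' c) + e j)) := by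
          refine h1.trans (mul_le_mul_right (add_le_add hx (h2.trans ?_)) _)
          exact mul_le_mul_right (add_le_add le_rfl hy) _
      _ = K * (e j + K * e j) + (K * K) * ∑ c ∈ J j, w c (x' c - y' c) := by ring
      _ ≤ (K + K * K) * (e j + K * e j) + (K + K * K) * ∑ c ∈ J j, w c (x' c - y' c) := by
          gcongr
          · exact le_self_add
          · exact le_add_self
      _ = _ := by ring
  have hC : (K + K * K : ℝ≥0∞) ≠ ∞ := by finiteness
  constructor
  · intro hF
    refine tsum_ne_top_of_le_mul_add hC hue (fun j => hchain j _ (θ (fill u)) (θ (fill v)) _ ?_ ?_)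
      (ENNReal.add_ne_top.1 hF).2
    · simpa only [hw.sub_comm _ (T j _ _)] using hu' j
    · simpa only [hw.sub_comm _ (T j _ _)] using hv' j
  · intro hD
    exact ENNReal.add_ne_top.2 ⟨hhead, tsum_ne_top_of_le_mul_add hC hue
      (fun j => hchain j _ _ _ _ (hu' j) (hv' j)) hD⟩

/-! ### The costs attached to a subset of `ω` -/

open scoped Nat

/-- The absolute value, truncated at `1`. -/
noncomputable def trunc (s : ℝ) : ℝ≥0∞ := min ‖s‖ₑ 1

theorem trunc_le_one (s : ℝ) : trunc s ≤ 1 := min_le_right _ _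

theorem trunc_ne_top (s : ℝ) : trunc s ≠ ∞ := ne_top_of_le_ne_top ENNReal.one_ne_top (trunc_le_one s)

@[simp] theorem trunc_zero : trunc 0 = 0 := by simp [trunc]

theorem trunc_neg (s : ℝ) : trunc (-s) = trunc s := by simp [trunc]

theorem trunc_add_le (s t : ℝ) : trunc (s + t) ≤ trunc s + trunc t := by
  unfold trunc
  rcases le_total ‖s‖ₑ 1 with hs | hs
  · rcases le_total ‖t‖ₑ 1 with ht | ht
    · rw [min_eq_left hs, min_eq_left ht]
      exact (min_le_left _ _).trans (enorm_add_le s t)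
    · rw [min_eq_right ht]; exact (min_le_right _ _).trans le_add_self
  · rw [min_eq_right hs]; exact (min_le_right _ _).trans le_self_add

theorem trunc_sub_le_sum (s : ℕ → ℝ) (n : ℕ) :
    trunc (s 0 - s n) ≤ ∑ i ∈ Finset.range n, trunc (s i - s (i + 1)) := by
  induction n with
  | zero => simp
  | succ n ih =>
    rw [Finset.sum_range_succ, ← sub_add_sub_cancel (s 0) (s n)]
    exact (trunc_add_le _ _).trans (add_le_add ih le_rfl)

theorem continuous_trunc : Continuous trunc := by
  unfold trunc; fun_prop

theorem trunc_rpow_add_le {p r : ℝ} (hr : 1 ≤ r) (hrp : r ≤ p + 1) (s t : ℝ) :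
    trunc (s + t) ^ r ≤ (2 ^ (p + 1) : ℝ≥0) * (trunc s ^ r + trunc t ^ r) := by
  refine (ENNReal.rpow_le_rpow (trunc_add_le s t) (by linarith)).trans
    ((ENNReal.rpow_add_le_mul_rpow_add_rpow _ _ hr).trans (mul_le_mul_left ?_ _))
  rw [ENNReal.coe_rpow_of_ne_zero two_ne_zero]
  exact ENNReal.rpow_le_rpow_of_exponent_le (by simp) (by linarith)

theorem trunc_rpow_anti {q r : ℝ} (h : q ≤ r) (s : ℝ) : trunc s ^ r ≤ trunc s ^ q :=
  ENNReal.rpow_le_rpow_of_exponent_ge (trunc_le_one s) h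

/-- The amount by which the exponent of the second term of `rowCost p t` exceeds `p`. -/
noncomputable def exponentGap (t : ℕ) : ℝ := (t : ℝ) ^ 2 / (t ! : ℝ) ^ 2

/-- The number of steps into which the unit interval is divided in row `t`. It is chosen such that
`gridSize t ^ exponentGap t = 2 ^ t ^ 2`. -/
def gridSize (t : ℕ) : ℕ := 2 ^ t ! ^ 2

/-- The cost function of row `t`. Each of these functions is comparable to `trunc s ^ p`, but not
uniformly in `t`: subdividing the unit interval into `gridSize t` steps shows an excess over the
`p`-th power by a factor of about `2 ^ t ^ 2`, an excess that no other row shows for that number of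
steps. -/
noncomputable def rowCost (p : ℝ) (t : ℕ) (s : ℝ) : ℝ≥0∞ :=
  2⁻¹ ^ t ^ 2 * trunc s ^ p + trunc s ^ (p + exponentGap t)

open Classical in
/-- The cost functions of the relation attached to `U`. The coordinate `n` belongs to the row
`n.unpair.1`; the rows in `U` carry `rowCost p`, the others the truncated `p`-th power. -/
noncomputable def setCost (p : ℝ) (U : Set ℕ) (n : ℕ) (s : ℝ) : ℝ≥0∞ :=
  if n.unpair.1 ∈ U then rowCost p n.unpair.1 s else trunc s ^ p

theorem setCost_of_mem {p : ℝ} {U : Set ℕ} {n : ℕ} (h : n.unpair.1 ∈ U) :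
    setCost p U n = rowCost p n.unpair.1 := funext fun _ => if_pos h

theorem setCost_of_notMem {p : ℝ} {U : Set ℕ} {n : ℕ} (h : n.unpair.1 ∉ U) :
    setCost p U n = fun s => trunc s ^ p := funext fun _ => if_neg h

theorem exponentGap_nonneg (t : ℕ) : 0 ≤ exponentGap t := by
  unfold exponentGap; positivity

theorem exponentGap_le_one (t : ℕ) : exponentGap t ≤ 1 := by
  have h : (t : ℝ) ≤ t ! := by exact_mod_cast t.self_le_factorial
  exact div_le_one_of_le₀ (by gcongr) (by positivity)

theorem tendsto_exponentGap : Tendsto exponentGap atTop (𝓝 0) := by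
  rw [← tendsto_add_atTop_iff_nat 1]
  have h : ∀ t, exponentGap (t + 1) = ((t ! : ℝ)⁻¹) ^ 2 := fun t => by
    unfold exponentGap
    rw [Nat.factorial_succ]; push_cast
    field_simp
  simp only [h]
  have : Tendsto (fun t : ℕ => ((t ! : ℝ)⁻¹)) atTop (𝓝 0) :=
    (tendsto_natCast_atTop_atTop.comp 
      (tendsto_atTop_mono Nat.self_le_factorial tendsto_id)).inv_tendsto_atTop
  simpa using this.pow 2

theorem gridSize_pos (t : ℕ) : 0 < gridSize t := by unfold gridSize; positivity

theorem gridSize_rpow (t : ℕ) (r : ℝ) :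
    (gridSize t : ℝ≥0∞) ^ r = 2 ^ ((t ! : ℝ) ^ 2 * r) := by
  rw [gridSize, ENNReal.rpow_mul, Nat.cast_pow]
  congr 1
  rw [← ENNReal.rpow_natCast]; push_cast; rfl

theorem gridSize_rpow_exponentGap (t : ℕ) : (gridSize t : ℝ≥0∞) ^ exponentGap t = 2 ^ t ^ 2 := by
  have : (t ! : ℝ) ^ 2 * exponentGap t = ((t ^ 2 : ℕ) : ℝ) := by
    unfold exponentGap; push_cast; field_simp
  rw [gridSize_rpow, this, ENNReal.rpow_natCast]

theorem gridSize_rpow_exponentGap_le_two {t m : ℕ} (h : t < m) :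
    (gridSize t : ℝ≥0∞) ^ exponentGap m ≤ 2 := by
  have h1 : t ! * m ≤ m ! := by
    obtain ⟨k, rfl⟩ : ∃ k, m = k + 1 := ⟨m - 1, by omega⟩
    rw [Nat.factorial_succ, mul_comm]
    exact Nat.mul_le_mul_left _ (Nat.factorial_le (by omega))
  have h2 : (t ! : ℝ) * m ≤ m ! := by exact_mod_cast h1
  have : (t ! : ℝ) ^ 2 * exponentGap m ≤ 1 := by
    unfold exponentGap
    rw [← mul_div_assoc, ← mul_pow]
    exact div_le_one_of_le₀ (by gcongr) (by positivity)
  rw [gridSize_rpow]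
  simpa using ENNReal.rpow_le_rpow_of_exponent_le (x := 2) (by simp) this

section Costs

variable {p : ℝ}

theorem rowCost_ne_top (hp : 1 ≤ p) (t : ℕ) (s : ℝ) : rowCost p t s ≠ ∞ := by
  have := exponentGap_nonneg t
  exact ENNReal.add_ne_top.2 ⟨ENNReal.mul_ne_top (by simp)
    (ENNReal.rpow_ne_top_of_nonneg (by linarith) (trunc_ne_top s)),
    ENNReal.rpow_ne_top_of_nonneg (by linarith) (trunc_ne_top s)⟩

theorem rowCost_le (t : ℕ) (s : ℝ) : rowCost p t s ≤ 2 * trunc s ^ p := by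
  have h := exponentGap_nonneg t
  rw [two_mul]
  refine add_le_add (mul_le_of_le_one_left' (pow_le_one' (by simp) _)) (trunc_rpow_anti (by linarith) s)

theorem le_rowCost (t : ℕ) (s : ℝ) : trunc s ^ p ≤ 2 ^ t ^ 2 * rowCost p t s := by
  calc trunc s ^ p = 2 ^ t ^ 2 * (2⁻¹ ^ t ^ 2 * trunc s ^ p) := by
        rw [← mul_assoc, ← mul_pow, ENNReal.mul_inv_cancel (by simp) (by simp), one_pow, one_mul]
    _ ≤ _ := by unfold rowCost; gcongr; exact le_self_add

theorem isCost_setCost (hp : 1 ≤ p) (U : Set ℕ) : IsCost (setCost p U) (2 ^ (p + 1)) := by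
  have hp0 : 0 < p := by linarith
  have hcont : ∀ r : ℝ, Continuous fun s => trunc s ^ r := fun r =>
    ENNReal.continuous_rpow_const.comp continuous_trunc
  have hcontc : ∀ n, Continuous (setCost p U n) := fun n => by
    by_cases h : n.unpair.1 ∈ U
    · rw [setCost_of_mem h]
      unfold rowCost
      exact ((ENNReal.continuous_const_mul (by simp)).comp (hcont p)).add (hcont _)
    · rw [setCost_of_notMem h]; exact hcont p
  have hzero : ∀ n, setCost p U n 0 = 0 := fun n => by
    have := exponentGap_nonneg n.unpair.1
    by_cases h : n.unpair.1 ∈ U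
    · rw [setCost_of_mem h, rowCost, trunc_zero, ENNReal.zero_rpow_of_pos hp0,
        ENNReal.zero_rpow_of_pos (by linarith)]; simp
    · rw [setCost_of_notMem h]; simp [hp0]
  refine ⟨fun n => (hcontc n).measurable, hzero, fun n s => ?_, fun n s => ?_, fun n s t => ?_,
    fun n => ?_⟩
  · simp only [setCost, rowCost, trunc_neg]
  · by_cases h : n.unpair.1 ∈ U
    · rw [setCost_of_mem h]; exact rowCost_ne_top hp _ s
    · rw [setCost_of_notMem h]
      exact ENNReal.rpow_ne_top_of_nonneg hp0.le (trunc_ne_top s)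
  · have h0 := exponentGap_nonneg n.unpair.1
    have h1 := exponentGap_le_one n.unpair.1
    have hpr := trunc_rpow_add_le (p := p) hp (by linarith) s t
    by_cases h : n.unpair.1 ∈ U
    · rw [setCost_of_mem h]
      calc rowCost p n.unpair.1 (s + t)
          ≤ 2⁻¹ ^ n.unpair.1 ^ 2 * ((2 ^ (p + 1) : ℝ≥0) * (trunc s ^ p + trunc t ^ p)) +
            (2 ^ (p + 1) : ℝ≥0) * (trunc s ^ (p + exponentGap n.unpair.1) +
              trunc t ^ (p + exponentGap n.unpair.1)) :=
            add_le_add (mul_le_mul_right hpr _)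
              (trunc_rpow_add_le (by linarith) (by linarith) s t)
        _ = _ := by unfold rowCost; ring
    · rw [setCost_of_notMem h]; exact hpr
  · simpa only [hzero] using (hcontc n).tendsto 0

theorem rowCost_one (t : ℕ) {s : ℝ} (hs : trunc s = 1) : 1 ≤ rowCost p t s := by
  simp [rowCost, hs]

theorem rowCost_inv_gridSize (t : ℕ) {s : ℝ} (hs : trunc s = (gridSize t : ℝ≥0∞)⁻¹) :
    rowCost p t s = 2 * 2⁻¹ ^ t ^ 2 * ((gridSize t : ℝ≥0∞) ^ p)⁻¹ := by
  have h0 : (gridSize t : ℝ≥0∞) ≠ 0 := by exact_mod_cast (gridSize_pos t).ne'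
  rw [rowCost, hs, ENNReal.inv_rpow, ENNReal.inv_rpow, ENNReal.rpow_add _ _ h0 (by simp),
    gridSize_rpow_exponentGap, ENNReal.mul_inv (by simp) (by simp), ENNReal.inv_pow]
  ring

/-- Joining `gridSize t` steps into one multiplies costs by at most about `gridSize t ^ (p - 1)`, up
to the excess `2 ^ (t - 1) ^ 2` of the rows before `t`, provided that row `t` itself carries the
truncated `p`-th power. -/
theorem setCost_sub_le_sum (hp : 1 ≤ p) {V : Set ℕ} {t : ℕ} (ht : t ∉ V) (c : ℕ) (s : ℕ → ℝ) :
    setCost p V c (s 0 - s (gridSize t)) ≤ 2 * 2 ^ (t - 1) ^ 2 * (gridSize t : ℝ≥0∞) ^ (p - 1) *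
      ∑ i ∈ Finset.range (gridSize t), setCost p V c (s i - s (i + 1)) := by
  set N := gridSize t with hN
  have h0 : (N : ℝ≥0∞) ≠ 0 := by exact_mod_cast (gridSize_pos t).ne'
  have hpow : ∀ r : ℝ, 1 ≤ r → trunc (s 0 - s N) ^ r ≤
      (N : ℝ≥0∞) ^ (r - 1) * ∑ i ∈ Finset.range N, trunc (s i - s (i + 1)) ^ r := by
    intro r hr
    refine (ENNReal.rpow_le_rpow (trunc_sub_le_sum s N) (by linarith)).trans ?_
    simpa using ENNReal.rpow_sum_le_const_mul_sum_rpow (Finset.range N)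
      (fun i => trunc (s i - s (i + 1))) hr
  have hone : (1 : ℝ≥0∞) ≤ 2 ^ (t - 1) ^ 2 := one_le_pow₀ (by simp)
  by_cases hc : c.unpair.1 ∈ V
  · rw [setCost_of_mem hc]
    set m := c.unpair.1
    have hmt : m ≠ t := fun h => ht (h ▸ hc)
    rcases lt_or_gt_of_ne hmt with h | h
    · calc rowCost p m (s 0 - s N) ≤ 2 * ((N : ℝ≥0∞) ^ (p - 1) *
            ∑ i ∈ Finset.range N, 2 ^ (t - 1) ^ 2 * rowCost p m (s i - s (i + 1))) := by
            refine (rowCost_le m _).trans (mul_le_mul_right ((hpow p hp).trans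
              (mul_le_mul_right (Finset.sum_le_sum fun i _ => ?_) _)) _)
            refine (le_rowCost m _).trans (mul_le_mul_left ?_ _)
            exact pow_le_pow_right₀ (by simp) (Nat.pow_le_pow_left (by omega) 2)
        _ = _ := by rw [← Finset.mul_sum]; ring
    · have hgap := exponentGap_nonneg m
      have h2 : (N : ℝ≥0∞) ^ (p + exponentGap m - 1) ≤ 2 * (N : ℝ≥0∞) ^ (p - 1) := by
        rw [show p + exponentGap m - 1 = exponentGap m + (p - 1) by ring,
          ENNReal.rpow_add _ _ h0 (by simp)]
        exact mul_le_mul_left (gridSize_rpow_exponentGap_le_two h) _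
      have h1 : (N : ℝ≥0∞) ^ (p - 1) ≤ 2 * (N : ℝ≥0∞) ^ (p - 1) :=
        le_mul_of_one_le_left' (by simp)
      calc rowCost p m (s 0 - s N)
          ≤ 2⁻¹ ^ m ^ 2 * (2 * (N : ℝ≥0∞) ^ (p - 1) *
              ∑ i ∈ Finset.range N, trunc (s i - s (i + 1)) ^ p) +
            2 * (N : ℝ≥0∞) ^ (p - 1) *
              ∑ i ∈ Finset.range N, trunc (s i - s (i + 1)) ^ (p + exponentGap m) :=
            add_le_add (mul_le_mul_right ((hpow p hp).trans (mul_le_mul_left h1 _)) _)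
              ((hpow _ (by linarith)).trans (mul_le_mul_left h2 _))
        _ = 2 * (N : ℝ≥0∞) ^ (p - 1) * ∑ i ∈ Finset.range N, rowCost p m (s i - s (i + 1)) := by
            simp only [rowCost, Finset.sum_add_distrib, ← Finset.mul_sum]; ring
        _ ≤ _ := by
            refine mul_le_mul_left (mul_le_mul_left ?_ _) _
            exact le_mul_of_one_le_right' hone
  · rw [setCost_of_notMem hc]
    refine (hpow p hp).trans (mul_le_mul_left (le_mul_of_one_le_left' ?_) _)
    exact one_le_mul (by simp) hone

theorem sum_setCost_sub_le (hp : 1 ≤ p) {V : Set ℕ} {t : ℕ} (ht : t ∉ V) (J : Finset ℕ)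
    (T : ℕ → ℕ → ℝ) {δ : ℝ≥0∞}
    (hδ : ∀ i < gridSize t, ∑ c ∈ J, setCost p V c (T i c - T (i + 1) c) ≤ δ) :
    ∑ c ∈ J, setCost p V c (T 0 c - T (gridSize t) c) ≤
      2 * 2 ^ (t - 1) ^ 2 * (gridSize t : ℝ≥0∞) ^ p * δ := by
  have h0 : (gridSize t : ℝ≥0∞) ≠ 0 := by exact_mod_cast (gridSize_pos t).ne'
  calc _ ≤ ∑ c ∈ J, 2 * 2 ^ (t - 1) ^ 2 * (gridSize t : ℝ≥0∞) ^ (p - 1) *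
        ∑ i ∈ Finset.range (gridSize t), setCost p V c (T i c - T (i + 1) c) :=
        Finset.sum_le_sum fun c _ => setCost_sub_le_sum hp ht c fun i => T i c
    _ = 2 * 2 ^ (t - 1) ^ 2 * (gridSize t : ℝ≥0∞) ^ (p - 1) *
        ∑ i ∈ Finset.range (gridSize t), ∑ c ∈ J, setCost p V c (T i c - T (i + 1) c) := by
        rw [← Finset.mul_sum, Finset.sum_comm]
    _ ≤ 2 * 2 ^ (t - 1) ^ 2 * (gridSize t : ℝ≥0∞) ^ (p - 1) * (gridSize t * δ) := by
        refine mul_le_mul_right ((Finset.sum_le_card_nsmul _ _ δ fun i hi => hδ i ?_).trans ?_) _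
        · exact Finset.mem_range.1 hi
        · simp
    _ = 2 * 2 ^ (t - 1) ^ 2 * ((gridSize t : ℝ≥0∞) ^ (p - 1) * (gridSize t : ℝ≥0∞) ^ (1 : ℝ)) * δ := by
        rw [ENNReal.rpow_one]; ring
    _ = _ := by rw [← ENNReal.rpow_add _ _ h0 (by simp)]; simp

end Costs

/-! ### Non-reducibility -/

theorem ENNReal.exists_nat_between {x : ℝ≥0∞} (hx : x ≠ ∞) : ∃ n : ℕ, x ≤ n ∧ (n : ℝ≥0∞) ≤ x + 1 := by
  lift x to ℝ≥0 using hx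
  refine ⟨⌈x⌉₊, by exact_mod_cast Nat.le_ceil x, ?_⟩
  exact_mod_cast (Nat.ceil_lt_add_one zero_le).le

theorem tsum_eq_tsum_tsum_pair (f : ℕ → ℝ≥0∞) :
    ∑' j, f j = ∑' t, ∑' i, f (Nat.pair t i) := by
  rw [← Nat.pairEquiv.tsum_eq, ENNReal.tsum_prod']
  rfl

theorem tsum_two_inv_pow_ne_top (C : ℝ≥0∞) (hC : C ≠ ∞) : ∑' t : ℕ, C * 2⁻¹ ^ t ≠ ∞ := by
  rw [ENNReal.tsum_mul_left, ENNReal.tsum_geometric]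
  exact ENNReal.mul_ne_top hC (by simp)

/-- If `U \ V` is infinite, no Borel reduction exists. In the block form of a reduction, look at the
paths of `gridSize t` steps for the rows `t ∈ U \ V`. Either many copies of row `t` have a step
that the reduction makes more expensive by a factor `2 ^ t`, or in some copy all steps
stay cheap; in the latter case the endpoints of that path come within cost `8 * 2⁻¹ ^ t` of each
other, whereas their cost in the source is at least `1`. One of these happens for infinitely many
`t`, and contradicts the preservation of convergence or of divergence. -/
theorem almostSubset_of_costEqRel_le {p : ℝ} (hp : 1 ≤ p) {U V : Set ℕ}
    (h : costEqRel (setCost p U) _ (isCost_setCost hp U) ≤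
      costEqRel (setCost p V) _ (isCost_setCost hp V)) : AlmostSubset U V := by
  classical
  by_contra hinf
  change (U \ V).Infinite at hinf
  obtain ⟨θ, hθ, hred⟩ := h
  have hred : ∀ x y : ℕ → ℝ, ∑' n, setCost p U n (x n - y n) ≠ ∞ ↔
      ∑' n, setCost p V n (θ x n - θ y n) ≠ ∞ := hred
  have hU := isCost_setCost hp U
  have hV := isCost_setCost hp V
  let grid : ℕ → ℕ → ℝ := fun i u =>
    if i.unpair.1 ∈ U \ V then (u : ℝ) / gridSize i.unpair.1 else 0
  have hgrid : Measurable fun (y : ℕ → ℕ) i => grid i (y i) :=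
    measurable_pi_lambda _ fun i => (measurable_of_countable (grid i)).comp (measurable_pi_apply i)
  have hS : ∀ j : ℕ, {i : ℕ | i.unpair.1 = j.unpair.1}.Infinite := fun j =>
    Set.infinite_of_injective_forall_mem (f := fun i => Nat.pair j.unpair.1 i)
      (fun i i' hii => (Nat.pair_eq_pair.1 hii).2) fun i => by simp
  obtain ⟨k, hk, J, T, H⟩ := exists_block_reduction
    (a := fun i u v => setCost p U i (grid i u - grid i v)) (by simp [hU.zero])
    (fun i u v => hU.ne_top _ _) hV (θ := fun y => θ fun i => grid i (y i)) (hθ.comp hgrid)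
    (fun x y => hred _ _) (fun i => gridSize i.unpair.1) hS
  have hk : ∀ j, (k j).unpair.1 = j.unpair.1 := hk
  simp only [hk] at H
  let d : ℕ → ℕ → ℕ → ℝ≥0∞ := fun j u v => ∑ c ∈ J j, setCost p V c (T j u c - T j v c)
  let N : ℕ → ℝ≥0∞ := fun t => gridSize t
  have hN0 : ∀ t, N t ≠ 0 := fun t => Nat.cast_ne_zero.2 (gridSize_pos t).ne'
  have hN0' : ∀ t, (gridSize t : ℝ) ≠ 0 := fun t => Nat.cast_ne_zero.2 (gridSize_pos t).ne'
  have hNp0 : ∀ t, N t ^ p ≠ 0 := fun t => by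
    simp [ENNReal.rpow_eq_zero_iff, hN0 t, N]
  have hNptop : ∀ t, N t ^ p ≠ ∞ := fun t => ENNReal.rpow_ne_top_of_nonneg (by linarith) (by simp [N])
  -- `α t` is the cost of one step of the path in row `t`.
  let α : ℕ → ℝ≥0∞ := fun t => 2 * 2⁻¹ ^ t ^ 2 * (N t ^ p)⁻¹
  have hα0 : ∀ t, α t ≠ 0 := fun t => by simp [α, hNptop t]
  have hαtop : ∀ t, α t ≠ ∞ := fun t =>
    ENNReal.mul_ne_top (ENNReal.mul_ne_top (by simp) (by simp)) (ENNReal.inv_ne_top.2 (hNp0 t))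
  have hαle : ∀ t, α t ≤ 2 * 2⁻¹ ^ t := fun t => by
    have h1 : (N t ^ p)⁻¹ ≤ 1 := by
      refine ENNReal.inv_le_one.2 (ENNReal.one_le_rpow ?_ (by linarith))
      exact Nat.one_le_cast.2 (gridSize_pos t)
    refine (mul_le_of_le_one_right' h1).trans (mul_le_mul_right ?_ _)
    exact pow_le_pow_right_of_le_one' (by simp) (Nat.le_self_pow two_ne_zero t)
  -- `M t` copies of a step are cheap in total, but no longer if their cost is raised by `2 ^ t`.
  choose M hM hM' using fun t => ENNReal.exists_nat_between
    (x := (2 ^ t * α t)⁻¹) (ENNReal.inv_ne_top.2 (mul_ne_zero (by simp) (hα0 t)))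
  have hMα : ∀ t, 1 ≤ M t * (2 ^ t * α t) := fun t => by
    have h1 : 2 ^ t * α t ≠ 0 := mul_ne_zero (by simp) (hα0 t)
    have h2 : 2 ^ t * α t ≠ ∞ := ENNReal.mul_ne_top (by simp) (hαtop t)
    exact (ENNReal.inv_mul_cancel h1 h2).symm.le.trans (mul_le_mul_left (hM t) _)
  have hMα' : ∀ t, M t * α t ≤ 3 * 2⁻¹ ^ t := fun t => by
    refine (mul_le_mul_left (hM' t) _).trans ?_
    rw [add_mul, one_mul, ENNReal.mul_inv (by simp) (by simp), mul_assoc,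
      ENNReal.inv_mul_cancel (hα0 t) (hαtop t), mul_one, ENNReal.inv_pow]
    refine (add_le_add le_rfl (hαle t)).trans_eq ?_
    ring
  have hstep : ∀ t ∈ U \ V, ∀ j : ℕ, j.unpair.1 = t → ∀ s : ℕ,
      setCost p U (k j) (grid (k j) s - grid (k j) (s + 1)) = α t := by
    intro t ht j hj s
    rw [setCost_of_mem (by rw [hk, hj]; exact ht.1), hk, hj]
    refine rowCost_inv_gridSize t ?_
    simp only [grid, hk, hj, ht, if_true]
    rw [← sub_div, Nat.cast_succ, sub_add_cancel_left, neg_div, trunc_neg, trunc, one_div, enorm_inv (hN0' t)]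
    have h1 : ‖(gridSize t : ℝ)‖ₑ = gridSize t := by
      rw [← ofReal_norm, Real.norm_natCast, ENNReal.ofReal_natCast]
    rw [h1]
    refine min_eq_left (ENNReal.inv_le_one.2 ?_)
    exact_mod_cast gridSize_pos t
  have htop : ∀ t ∈ U \ V, ∀ j : ℕ, j.unpair.1 = t →
      1 ≤ setCost p U (k j) (grid (k j) 0 - grid (k j) (gridSize t)) := by
    intro t ht j hj
    rw [setCost_of_mem (by rw [hk, hj]; exact ht.1), hk, hj]
    refine rowCost_one t ?_
    simp only [grid, hk, hj, ht, if_true]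
    rw [Nat.cast_zero, zero_div, zero_sub, trunc_neg, div_self (hN0' t), trunc]
    simp
  let P : ℕ → Prop := fun t =>
    ∀ i < M t, ∃ s < gridSize t, 2 ^ t * α t < d (Nat.pair t i) s (s + 1)
  have hsplit : {t ∈ U \ V | P t}.Infinite ∨ {t ∈ U \ V | ¬ P t}.Infinite := by
    rw [← Set.infinite_union]
    convert hinf using 1
    ext t
    by_cases hPt : P t <;> simp [hPt]
  rcases hsplit with hP | hP
  · -- Many expensive steps: the source cost converges and the target cost diverges.
    have hs : ∀ j : ℕ, ∃ s < gridSize j.unpair.1, (P j.unpair.1 → j.unpair.2 < M j.unpair.1 →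
        2 ^ j.unpair.1 * α j.unpair.1 < d j s (s + 1)) := fun j => by
      by_cases h : P j.unpair.1 ∧ j.unpair.2 < M j.unpair.1
      · obtain ⟨s, hs, hs'⟩ := h.1 _ h.2
        rw [Nat.pair_unpair] at hs'
        exact ⟨s, hs, fun _ _ => hs'⟩
      · exact ⟨0, gridSize_pos _, fun h1 h2 => (h ⟨h1, h2⟩).elim⟩
    choose s hs hs' using hs
    let Q : ℕ → Prop := fun j =>
      (j.unpair.1 ∈ U \ V ∧ P j.unpair.1) ∧ j.unpair.2 < M j.unpair.1
    have H1 := H (fun j => if Q j then s j else 0) (fun j => if Q j then s j + 1 else 0)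
      (fun j => by
        split_ifs
        · exact (hs j).le
        · exact Nat.zero_le _)
      (fun j => by
        split_ifs
        · exact hs j
        · exact Nat.zero_le _)
    refine (H1.1 ?_) ?_
    · rw [tsum_eq_tsum_tsum_pair]
      refine ne_top_of_le_ne_top (tsum_two_inv_pow_ne_top 3 (by simp))
        (ENNReal.tsum_le_tsum fun t => le_trans ?_ (hMα' t))
      rw [tsum_eq_sum (s := Finset.range (M t)) fun i hi => ?_]
      · refine (Finset.sum_le_card_nsmul _ _ (α t) fun i hi => ?_).trans (by simp)
        by_cases hQ : Q (Nat.pair t i)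
        · rw [if_pos hQ, if_pos hQ]
          refine (hstep t ?_ _ (by simp) _).le
          simpa using hQ.1.1
        · rw [if_neg hQ, if_neg hQ, sub_self, hU.zero]; exact zero_le
      · have hQ : ¬ Q (Nat.pair t i) := fun hQ => hi (by simpa using hQ.2)
        rw [if_neg hQ, if_neg hQ, sub_self, hU.zero]
    · rw [tsum_eq_tsum_tsum_pair]
      by_contra hne
      refine hP ((ENNReal.finite_const_le_of_tsum_ne_top hne one_ne_zero).subset fun t ht => ?_)
      have ht : t ∈ U \ V ∧ P t := ht
      refine (hMα t).trans (le_trans ?_ (ENNReal.sum_le_tsum (Finset.range (M t))))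
      rw [← nsmul_eq_mul]
      refine le_of_eq_of_le ?_ (Finset.card_nsmul_le_sum _ _ (2 ^ t * α t) fun i hi => ?_)
      · simp
      · have hQ : Q (Nat.pair t i) := by simpa [Q, Nat.unpair_pair] using ⟨ht, Finset.mem_range.1 hi⟩
        simp only [if_pos hQ]
        simpa using (hs' (Nat.pair t i) hQ.1.2 hQ.2).le
  · -- Cheap paths: the source cost diverges and the target cost converges.
    have hi : ∀ t, ∃ i, ¬ P t → ∀ r < gridSize t, d (Nat.pair t i) r (r + 1) ≤ 2 ^ t * α t := fun t => by
      by_cases hPt : P t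
      · exact ⟨0, fun h => (h hPt).elim⟩
      · obtain ⟨i, -, hi⟩ : ∃ i < M t, ∀ r < gridSize t,
            d (Nat.pair t i) r (r + 1) ≤ 2 ^ t * α t := by
          simpa only [P, not_forall, not_exists, not_and, not_lt, exists_prop] using hPt
        exact ⟨i, fun _ => hi⟩
    choose i hi using hi
    let Q : ℕ → Prop := fun j =>
      (j.unpair.1 ∈ U \ V ∧ ¬ P j.unpair.1) ∧ j.unpair.2 = i j.unpair.1
    have H1 := H (fun _ => 0) (fun j => if Q j then gridSize j.unpair.1 else 0)
      (fun j => Nat.zero_le _)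
      (fun j => by
        split_ifs
        · exact le_rfl
        · exact Nat.zero_le _)
    refine H1.2 ?_ ?_
    · rw [tsum_eq_tsum_tsum_pair]
      refine ne_top_of_le_ne_top (tsum_two_inv_pow_ne_top 8 (by simp))
        (ENNReal.tsum_le_tsum fun t => ?_)
      rw [tsum_eq_single (i t) fun i' hi' => ?_]
      · by_cases hQ : Q (Nat.pair t (i t))
        · simp only [if_pos hQ]
          have ht : t ∈ U \ V ∧ ¬ P t := by simpa using hQ.1
          have h1 := sum_setCost_sub_le hp ht.1.2 (J (Nat.pair t (i t))) (T (Nat.pair t (i t)))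
            (hi t ht.2)
          rw [Nat.unpair_pair]
          refine h1.trans ?_
          have h2 : (t - 1) ^ 2 + 2 * t ≤ t ^ 2 + 1 := by
            rcases t with _ | t
            · simp
            · simp only [Nat.add_sub_cancel]; nlinarith
          have h3 : (2 : ℝ≥0∞) ^ (t - 1) ^ 2 * 2 ^ t * 2⁻¹ ^ t ^ 2 ≤ 2 * 2⁻¹ ^ t := by
            rw [← ENNReal.inv_pow, ← ENNReal.inv_pow, ← div_eq_mul_inv, ← div_eq_mul_inv,
              ENNReal.div_le_iff (by simp) (by simp), div_eq_mul_inv, mul_right_comm,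
              ← div_eq_mul_inv, ENNReal.le_div_iff_mul_le (by simp) (by simp)]
            calc (2 : ℝ≥0∞) ^ (t - 1) ^ 2 * 2 ^ t * 2 ^ t = 2 ^ ((t - 1) ^ 2 + 2 * t) := by ring
              _ ≤ 2 ^ (t ^ 2 + 1) := pow_le_pow_right₀ (by simp) h2
              _ = _ := by ring
          calc 2 * 2 ^ (t - 1) ^ 2 * N t ^ p * (2 ^ t * α t)
              = 4 * (2 ^ (t - 1) ^ 2 * 2 ^ t * 2⁻¹ ^ t ^ 2) * (N t ^ p * (N t ^ p)⁻¹) := by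
                simp only [α]; ring
            _ ≤ 4 * (2 * 2⁻¹ ^ t) := by
                rw [ENNReal.mul_inv_cancel (hNp0 t) (hNptop t), mul_one]
                exact mul_le_mul_right h3 _
            _ = 8 * 2⁻¹ ^ t := by ring
        · simp only [if_neg hQ, sub_self, hV.zero, Finset.sum_const_zero]; exact zero_le
      · have hQ : ¬ Q (Nat.pair t i') := fun hQ => hi' (by simpa using hQ.2)
        simp only [if_neg hQ, sub_self, hV.zero, Finset.sum_const_zero]
    · rw [tsum_eq_tsum_tsum_pair]
      by_contra hne
      refine hP ((ENNReal.finite_const_le_of_tsum_ne_top hne one_ne_zero).subset fun t ht => ?_)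
      have ht : t ∈ U \ V ∧ ¬ P t := ht
      have hQ : Q (Nat.pair t (i t)) := by simpa [Q, Nat.unpair_pair] using ht
      refine le_trans ?_ (ENNReal.le_tsum (i t))
      simp only [if_pos hQ]
      rw [Nat.unpair_pair]
      exact htop t ht.1 _ (by simp)

/-! ### Reductions between the relations attached to sets -/

theorem tsum_enorm_rpow_ne_top_iff {p : ℝ} (hp : 0 ≤ p) (s : ℕ → ℝ) :
    ∑' n, ‖s n‖ₑ ^ p ≠ ∞ ↔ ∑' n, trunc (s n) ^ p ≠ ∞ := by
  refine ⟨fun h => ne_top_of_le_ne_top h (ENNReal.tsum_le_tsum fun n =>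
    ENNReal.rpow_le_rpow (min_le_left _ _) hp), fun h => tsum_ne_top_of_le_of_lt_one
      ENNReal.one_ne_top (fun n => ENNReal.rpow_ne_top_of_nonneg hp enorm_ne_top) (fun n hn => ?_) h⟩
  rcases le_total ‖s n‖ₑ 1 with h1 | h1
  · rw [trunc, min_eq_left h1, one_mul]
  · rw [trunc, min_eq_right h1, ENNReal.one_rpow] at hn
    exact absurd hn (lt_irrefl _)

theorem setCost_le (p : ℝ) (U : Set ℕ) (n : ℕ) (s : ℝ) : setCost p U n s ≤ 2 * trunc s ^ p := by
  by_cases h : n.unpair.1 ∈ U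
  · rw [setCost_of_mem h]; exact rowCost_le _ s
  · rw [setCost_of_notMem h]; exact le_mul_of_one_le_left' (by simp)

theorem le_setCost (p : ℝ) (U : Set ℕ) (n : ℕ) (s : ℝ) :
    trunc s ^ p ≤ 2 ^ n.unpair.1 ^ 2 * setCost p U n s := by
  by_cases h : n.unpair.1 ∈ U
  · rw [setCost_of_mem h]; exact le_rowCost _ s
  · rw [setCost_of_notMem h]; exact le_mul_of_one_le_left' (one_le_pow₀ (by simp))

theorem tsum_ne_top_iff_of_le_mul {f g : ℕ → ℝ≥0∞} {C : ℝ≥0∞} (hC : C ≠ ∞)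
    (hfg : ∀ n, f n ≤ C * g n) (hgf : ∀ n, g n ≤ C * f n) :
    ∑' n, f n ≠ ∞ ↔ ∑' n, g n ≠ ∞ := by
  have key : ∀ f g : ℕ → ℝ≥0∞, (∀ n, f n ≤ C * g n) → ∑' n, g n ≠ ∞ → ∑' n, f n ≠ ∞ :=
    fun f g h hg => ne_top_of_le_ne_top (ENNReal.mul_ne_top hC hg)
      ((ENNReal.tsum_le_tsum h).trans_eq ENNReal.tsum_mul_left)
  exact ⟨key g f hgf, key f g hfg⟩

theorem realModEll_le_costEqRel {p : ℝ} (hp : 1 ≤ p) (U : Set ℕ) :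
    realModEll (ENNReal.ofReal p) ≤ costEqRel (setCost p U) _ (isCost_setCost hp U) := by
  have he : (fun n => Nat.pair 0 n).Injective := fun i j h => (Nat.pair_eq_pair.1 h).2
  refine ⟨fun x => Function.extend (fun n => Nat.pair 0 n) x 0, measurable_extend_zero he,
    fun (x y : ℕ → ℝ) => (realModEll_rel_iff (by linarith) x y).trans
      ((tsum_enorm_rpow_ne_top_iff (by linarith) fun n => x n - y n).trans ?_)⟩
  change _ ↔ ∑' n, setCost p U n
    (Function.extend (fun n => Nat.pair 0 n) x 0 n - Function.extend (fun n => Nat.pair 0 n) y 0 n) ≠ ∞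
  rw [tsum_extend_sub (isCost_setCost hp U).zero he]
  refine tsum_ne_top_iff_of_le_mul (C := 2) (by simp) (fun n => ?_) (fun n => setCost_le p U _ _)
  refine (le_setCost p U (Nat.pair 0 n) _).trans (mul_le_mul_left ?_ _)
  simp

theorem costEqRel_le_of_almostSubset {p : ℝ} (hp : 1 ≤ p) {U V : Set ℕ} (h : AlmostSubset U V) :
    costEqRel (setCost p U) _ (isCost_setCost hp U) ≤
      costEqRel (setCost p V) _ (isCost_setCost hp V) := by
  classical
  -- The rows in `U ∩ V` stay in place, in the even positions; all others go to row `0`.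
  let e : ℕ → ℕ := fun n =>
    if n.unpair.1 ∈ U ∩ V then Nat.pair n.unpair.1 (2 * n.unpair.2) else Nat.pair 0 (2 * n + 1)
  have he : e.Injective := fun i j hij => by
    simp only [e] at hij
    split_ifs at hij with hi hj hj
    · obtain ⟨h1, h2⟩ := Nat.pair_eq_pair.1 hij
      rw [← Nat.pair_unpair i, ← Nat.pair_unpair j, h1, show i.unpair.2 = j.unpair.2 by omega]
    all_goals
      have h2 := (Nat.pair_eq_pair.1 hij).2
      omega
  obtain ⟨b, hb⟩ := h.bddAbove
  refine ⟨fun x => Function.extend e x 0, measurable_extend_zero he, fun (x y : ℕ → ℝ) => ?_⟩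
  change ∑' n, setCost p U n (x n - y n) ≠ ∞ ↔
    ∑' n, setCost p V n (Function.extend e x 0 n - Function.extend e y 0 n) ≠ ∞
  rw [tsum_extend_sub (isCost_setCost hp V).zero he]
  have h1 : (1 : ℝ≥0∞) ≤ 2 * 2 ^ b ^ 2 := one_le_mul (by simp) (one_le_pow₀ (by simp))
  have h2 : (2 : ℝ≥0∞) ≤ 2 * 2 ^ b ^ 2 := le_mul_of_one_le_right' (one_le_pow₀ (by simp))
  have hcost : ∀ n s, setCost p U n s ≤ 2 * 2 ^ b ^ 2 * setCost p V (e n) s ∧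
      setCost p V (e n) s ≤ 2 * 2 ^ b ^ 2 * setCost p U n s := fun n s => by
    by_cases hn : n.unpair.1 ∈ U ∩ V
    · have hen : (e n).unpair.1 = n.unpair.1 := by simp only [e, if_pos hn, Nat.unpair_pair]
      have : setCost p V (e n) s = setCost p U n s := by
        rw [setCost_of_mem (hen ▸ hn.2), setCost_of_mem hn.1, hen]
      rw [this]
      exact ⟨le_mul_of_one_le_left' h1, le_mul_of_one_le_left' h1⟩
    · have hen : (e n).unpair.1 = 0 := by simp only [e, if_neg hn, Nat.unpair_pair]
      have h3 : trunc s ^ p ≤ setCost p V (e n) s := by simpa [hen] using le_setCost p V (e n) s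
      refine ⟨(setCost_le p U n s).trans (mul_le_mul' h2 h3), (setCost_le p V (e n) s).trans ?_⟩
      rw [mul_assoc]
      refine mul_le_mul_right ?_ _
      by_cases hU : n.unpair.1 ∈ U
      · refine (le_setCost p U n s).trans (mul_le_mul_left (pow_le_pow_right₀ (by simp) ?_) _)
        exact Nat.pow_le_pow_left (hb ⟨hU, fun hV => hn ⟨hU, hV⟩⟩) 2
      · rw [setCost_of_notMem hU]; exact le_mul_of_one_le_left' (one_le_pow₀ (by simp))
  exact tsum_ne_top_iff_of_le_mul (C := 2 * 2 ^ b ^ 2) (by finiteness)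
    (fun n => (hcost n _).1) (fun n => (hcost n _).2)

/-! ### Snowflake embeddings of the line into `ℓ_q` -/

/-- The `j`-th coordinate of the snowflake embedding: `ψ` (a sine or a cosine) at frequency `2 ^ j`,
with an amplitude whose `q`-th power is `2 ^ (-j * s)`. The `q`-th powers of the distances then add
up to about `|x - y| ^ s` when `s < q` and `|x - y| ≤ 1`. -/
noncomputable def snowflake (ψ : ℝ → ℝ) (q s : ℝ) (j : ℕ) (x : ℝ) : ℝ :=
  2 ^ (-(j * s / q)) * ψ (2 ^ j * x)

section Snowflake

variable {ψ : ℝ → ℝ} {q s η : ℝ}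

theorem enorm_snowflake_sub_rpow (hq : 0 < q) (j : ℕ) (x y : ℝ) :
    ‖snowflake ψ q s j x - snowflake ψ q s j y‖ₑ ^ q =
      ENNReal.ofReal (2 ^ (-(j * s)) * |ψ (2 ^ j * x) - ψ (2 ^ j * y)| ^ q) := by
  rw [← ofReal_norm, ENNReal.ofReal_rpow_of_nonneg (norm_nonneg _) hq.le, snowflake, snowflake,
    ← mul_sub, norm_mul, Real.mul_rpow (norm_nonneg _) (norm_nonneg _), Real.norm_eq_abs,
    Real.norm_eq_abs, abs_of_pos (by positivity), ← Real.rpow_mul (by norm_num)]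
  congr 3
  field_simp

theorem tsum_snowflake_ne_top (hψ : ∀ x y, |ψ x - ψ y| ≤ 2) (hq : 0 < q) (hs : 0 < s) (x y : ℝ) :
    ∑' j, ‖snowflake ψ q s j x - snowflake ψ q s j y‖ₑ ^ q ≠ ∞ := by
  have h : ∀ j : ℕ, ‖snowflake ψ q s j x - snowflake ψ q s j y‖ₑ ^ q ≤
      ENNReal.ofReal (2 ^ q) * ENNReal.ofReal (2 ^ (-s)) ^ j := fun j => by
    rw [enorm_snowflake_sub_rpow hq, ← ENNReal.ofReal_pow (by positivity),
      ← ENNReal.ofReal_mul (by positivity), ← Real.rpow_natCast (2 ^ (-s)),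
      ← Real.rpow_mul (by norm_num), mul_comm (2 ^ q), show -s * (j : ℝ) = -(j * s) by ring]
    refine ENNReal.ofReal_le_ofReal ?_
    gcongr
    exact hψ _ _
  refine ne_top_of_le_ne_top ?_ (ENNReal.tsum_le_tsum h)
  rw [ENNReal.tsum_mul_left, ENNReal.tsum_geometric]
  refine ENNReal.mul_ne_top (by simp) (ENNReal.inv_ne_top.2 (tsub_pos_of_lt ?_).ne')
  rw [ENNReal.ofReal_lt_one]
  exact Real.rpow_lt_one_of_one_lt_of_neg (by norm_num) (by linarith)

/-- The constant in the upper estimate for the snowflake embedding; it depends on the exponent `s`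
only through a lower bound `η` for `s` and `q - s`. -/
noncomputable def snowflakeConst (q η : ℝ) : ℝ≥0∞ :=
  ENNReal.ofReal (4 ^ q) * (2 * (1 - ENNReal.ofReal (2 ^ (-η)))⁻¹)

theorem snowflakeConst_ne_top (hη : 0 < η) : snowflakeConst q η ≠ ∞ := by
  have : ENNReal.ofReal (2 ^ (-η)) < 1 := by
    rw [ENNReal.ofReal_lt_one]
    exact Real.rpow_lt_one_of_one_lt_of_neg (by norm_num) (by linarith)
  exact ENNReal.mul_ne_top (by simp) (ENNReal.mul_ne_top (by simp)
    (ENNReal.inv_ne_top.2 (tsub_pos_of_lt this).ne'))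

theorem exists_two_rpow_near {r : ℝ} (hr0 : 0 < r) (hr1 : r ≤ 1) :
    ∃ n : ℕ, (2 : ℝ) ^ (-((n : ℝ) + 1)) < r ∧ r ≤ (2 : ℝ) ^ (-(n : ℝ)) := by
  obtain ⟨n, h1, h2⟩ := exists_nat_pow_near_of_lt_one hr0 hr1 (y := (2 : ℝ)⁻¹) (by norm_num)
    (by norm_num)
  refine ⟨n, ?_, ?_⟩
  · rw [Real.rpow_neg (by norm_num), ← Nat.cast_succ, Real.rpow_natCast, ← inv_pow]; exact h1
  · rw [Real.rpow_neg (by norm_num), Real.rpow_natCast, ← inv_pow]; exact h2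

theorem tsum_snowflake_le (hψ : ∀ x y, |ψ x - ψ y| ≤ 2) (hψ' : ∀ x y, |ψ x - ψ y| ≤ |x - y|)
    (hη : 0 < η) (hηs : η ≤ s) (hηq : η ≤ q - s) {x y : ℝ} (hxy : |x - y| ≤ 1) :
    ∑' j, ‖snowflake ψ q s j x - snowflake ψ q s j y‖ₑ ^ q ≤
      snowflakeConst q η * ‖x - y‖ₑ ^ s := by
  have hs : 0 < s := hη.trans_le hηs
  have hq : 0 < q := by linarith
  rcases eq_or_ne x y with rfl | hne
  · simp [hq]
  have hr0 : 0 < |x - y| := abs_pos.2 (sub_ne_zero.2 hne)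
  obtain ⟨n, h1, h2⟩ := exists_two_rpow_near hr0 hxy
  simp only [enorm_snowflake_sub_rpow hq]
  set F : ℕ → ℝ≥0∞ := fun j =>
    ENNReal.ofReal (2 ^ (-(j * s)) * |ψ (2 ^ j * x) - ψ (2 ^ j * y)| ^ q) with hF
  set ρ : ℝ≥0∞ := ENNReal.ofReal (2 ^ (-η)) with hρ
  set D : ℝ≥0∞ := ENNReal.ofReal (2 ^ q * 2 ^ (-(n * s))) with hD
  have hDρ : ∀ m : ℕ, D * ρ ^ m = ENNReal.ofReal (2 ^ (q - n * s - m * η)) := fun m => by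
    rw [hD, hρ, ← ENNReal.ofReal_pow (by positivity), ← ENNReal.ofReal_mul (by positivity),
      ← Real.rpow_natCast, ← Real.rpow_mul (by norm_num), ← Real.rpow_add (by norm_num),
      ← Real.rpow_add (by norm_num)]
    congr 2; ring
  have hlow : ∀ j < n, F j ≤ D * ρ ^ (n - 1 - j) := fun j hj => by
    have hj' : (j : ℝ) + 1 ≤ n := by exact_mod_cast hj
    rw [hDρ]
    refine ENNReal.ofReal_le_ofReal ?_
    have h3 : |ψ (2 ^ j * x) - ψ (2 ^ j * y)| ≤ 2 ^ ((j : ℝ) - n) := by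
      refine (hψ' _ _).trans ?_
      rw [← mul_sub, abs_mul, abs_of_pos (by positivity), sub_eq_add_neg (j : ℝ),
        Real.rpow_add (by norm_num), Real.rpow_natCast]
      gcongr
    calc _ ≤ (2 : ℝ) ^ (-(j * s)) * (2 ^ ((j : ℝ) - n)) ^ q := by gcongr
      _ = 2 ^ (-(j * s) + (j - n) * q) := by
          rw [← Real.rpow_mul (by norm_num), ← Real.rpow_add (by norm_num)]
      _ ≤ _ := by
          refine Real.rpow_le_rpow_of_exponent_le (by norm_num) ?_
          have : ((n - 1 - j : ℕ) : ℝ) = n - 1 - j := by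
            rw [Nat.sub_sub, Nat.cast_sub (by omega)]; push_cast; ring
          rw [this]
          nlinarith [mul_le_mul_of_nonneg_left hηq (sub_nonneg.2 hj')]
  have hhigh : ∀ j, F (j + n) ≤ D * ρ ^ j := fun j => by
    rw [hDρ]
    refine ENNReal.ofReal_le_ofReal ?_
    calc _ ≤ (2 : ℝ) ^ (-(((j + n : ℕ) : ℝ) * s)) * 2 ^ q := by
          gcongr
          exact hψ _ _
      _ = 2 ^ (-(((j + n : ℕ) : ℝ) * s) + q) := by rw [← Real.rpow_add (by norm_num)]
      _ ≤ _ := by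
          refine Real.rpow_le_rpow_of_exponent_le (by norm_num) ?_
          push_cast
          nlinarith [mul_le_mul_of_nonneg_left hηs j.cast_nonneg]
  have hDle : D ≤ ENNReal.ofReal (4 ^ q) * ‖x - y‖ₑ ^ s := by
    rw [← ofReal_norm, Real.norm_eq_abs, ENNReal.ofReal_rpow_of_pos hr0,
      ← ENNReal.ofReal_mul (by positivity)]
    refine ENNReal.ofReal_le_ofReal ?_
    have h3 : (2 : ℝ) ^ (-(n * s)) ≤ 2 ^ q * |x - y| ^ s := by
      calc (2 : ℝ) ^ (-(n * s)) = 2 ^ s * (2 ^ (-((n : ℝ) + 1))) ^ s := by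
            rw [← Real.rpow_mul (by norm_num), ← Real.rpow_add (by norm_num)]
            congr 1; ring
        _ ≤ 2 ^ q * |x - y| ^ s := by
            gcongr
            · norm_num
            · linarith
    calc (2 : ℝ) ^ q * 2 ^ (-(n * s)) ≤ 2 ^ q * (2 ^ q * |x - y| ^ s) := by gcongr
      _ = 4 ^ q * |x - y| ^ s := by
          rw [← mul_assoc, ← Real.mul_rpow (by norm_num) (by norm_num)]; norm_num
  calc ∑' j, F j = ∑ j ∈ Finset.range n, F j + ∑' j, F (j + n) :=
        (ENNReal.summable.sum_add_tsum_nat_add' (f := F) (k := n)).symm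
    _ ≤ ∑ j ∈ Finset.range n, D * ρ ^ (n - 1 - j) + ∑' j, D * ρ ^ j :=
        add_le_add (Finset.sum_le_sum fun j hj => hlow j (Finset.mem_range.1 hj))
          (ENNReal.tsum_le_tsum hhigh)
    _ ≤ ∑' j, D * ρ ^ j + ∑' j, D * ρ ^ j := by
        rw [Finset.sum_range_reflect (fun m => D * ρ ^ m) n]
        exact add_le_add (ENNReal.sum_le_tsum _) le_rfl
    _ = D * (2 * (1 - ρ)⁻¹) := by
        rw [ENNReal.tsum_mul_left, ENNReal.tsum_geometric]; ring
    _ ≤ ENNReal.ofReal (4 ^ q) * ‖x - y‖ₑ ^ s * (2 * (1 - ρ)⁻¹) := mul_le_mul_left hDle _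
    _ = _ := by rw [snowflakeConst]; ring

/-- At the frequency `2 ^ j` with `1 < 2 ^ j * |x - y| ≤ 2`, the sines or the cosines of the two
points differ by at least `1 / 2`. -/
theorem le_tsum_snowflake (hs : 0 < s) (hsq : s ≤ q) {x y : ℝ} (hxy : |x - y| ≤ 1) :
    ‖x - y‖ₑ ^ s ≤ ENNReal.ofReal (4 ^ q) *
      (∑' j, ‖snowflake Real.cos q s j x - snowflake Real.cos q s j y‖ₑ ^ q +
        ∑' j, ‖snowflake Real.sin q s j x - snowflake Real.sin q s j y‖ₑ ^ q) := by
  have hq : 0 < q := by linarith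
  rcases eq_or_ne x y with rfl | hne
  · simp [hs]
  have hr0 : 0 < |x - y| := abs_pos.2 (sub_ne_zero.2 hne)
  obtain ⟨n, h1, h2⟩ := exists_two_rpow_near hr0 hxy
  set a := (2 : ℝ) ^ (n + 1) * x
  set b := (2 : ℝ) ^ (n + 1) * y
  have hab : |a - b| = 2 ^ ((n : ℝ) + 1) * |x - y| := by
    rw [← mul_sub, abs_mul, abs_of_pos (by positivity), ← Nat.cast_succ, Real.rpow_natCast]
  have hab1 : 1 ≤ |a - b| := by
    rw [hab]
    calc (1 : ℝ) = 2 ^ ((n : ℝ) + 1) * 2 ^ (-((n : ℝ) + 1)) := by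
          rw [← Real.rpow_add (by norm_num)]; simp
      _ ≤ _ := by gcongr
  have hab2 : |a - b| ≤ 2 := by
    rw [hab]
    calc (2 : ℝ) ^ ((n : ℝ) + 1) * |x - y| ≤ 2 ^ ((n : ℝ) + 1) * 2 ^ (-(n : ℝ)) := by gcongr
      _ = 2 := by rw [← Real.rpow_add (by norm_num)]; simp
  have hcos : Real.cos (a - b) ≤ 5 / 9 := by
    rw [← Real.cos_abs]
    exact (Real.cos_le_cos_of_nonneg_of_le_pi zero_le_one
      (hab2.trans Real.two_le_pi) hab1).trans Real.cos_one_le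
  have hsq' : (8 : ℝ) / 9 ≤
      |Real.cos a - Real.cos b| ^ 2 + |Real.sin a - Real.sin b| ^ 2 := by
    rw [Real.cos_sub] at hcos
    rw [sq_abs, sq_abs]
    nlinarith [Real.sin_sq_add_cos_sq a, Real.sin_sq_add_cos_sq b]
  have key : ∀ ψ : ℝ → ℝ, 1 / 2 ≤ |ψ a - ψ b| → ‖x - y‖ₑ ^ s ≤ ENNReal.ofReal (4 ^ q) *
      ∑' j, ‖snowflake ψ q s j x - snowflake ψ q s j y‖ₑ ^ q := by
    intro ψ hψ
    refine le_trans ?_ (mul_le_mul_right (ENNReal.le_tsum (n + 1)) _)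
    rw [enorm_snowflake_sub_rpow hq, ← ofReal_norm, Real.norm_eq_abs,
      ENNReal.ofReal_rpow_of_pos hr0, ← ENNReal.ofReal_mul (by positivity)]
    refine ENNReal.ofReal_le_ofReal ?_
    calc |x - y| ^ s ≤ (2 ^ (-(n : ℝ))) ^ s := by gcongr
      _ = 2 ^ s * 2 ^ (-(((n + 1 : ℕ) : ℝ) * s)) := by
          rw [← Real.rpow_mul (by norm_num), ← Real.rpow_add (by norm_num)]
          congr 1; push_cast; ring
      _ ≤ 2 ^ q * 2 ^ (-(((n + 1 : ℕ) : ℝ) * s)) := by gcongr; norm_num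
      _ = 4 ^ q * (2 ^ (-(((n + 1 : ℕ) : ℝ) * s)) * (1 / 2) ^ q) := by
          rw [show (2 : ℝ) = 4 * (1 / 2) by norm_num, Real.mul_rpow (by norm_num) (by norm_num)]
          norm_num; ring
      _ ≤ _ := by gcongr
  rcases le_or_gt (1 / 2) |Real.cos a - Real.cos b| with h | h
  · exact (key Real.cos h).trans (mul_le_mul_right le_self_add _)
  · refine (key Real.sin ?_).trans (mul_le_mul_right le_add_self _)
    by_contra! h'
    have h3 := abs_nonneg (Real.cos a - Real.cos b)
    have h4 := abs_nonneg (Real.sin a - Real.sin b)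
    nlinarith

end Snowflake

/-! ### Reductions to `ℝ^ω / ℓ_q` -/

/-- A reduction to `ℝ^ω / ℓ_q` may use finitely many sequences of coordinates for each coordinate of
the source, provided that the resulting cost is comparable with the given one wherever the latter
is small. -/
theorem costEqRel_le_realModEll {w : ℕ → ℝ → ℝ≥0∞} {K : ℝ≥0} (hw : IsCost w K) {q : ℝ} (hq : 0 < q)
    {κ : Type*} [Fintype κ] [Nonempty κ] (Φ : ℕ → κ → ℕ → ℝ → ℝ) (hΦ : ∀ n k j, Measurable (Φ n k j))
    {C C' : ℝ≥0∞} (hC : C ≠ ∞) (hC' : C' ≠ ∞)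
    (hfin : ∀ n x y, ∑ k, ∑' j, ‖Φ n k j x - Φ n k j y‖ₑ ^ q ≠ ∞)
    (hle : ∀ n x y, w n (x - y) < 1 →
      ∑ k, ∑' j, ‖Φ n k j x - Φ n k j y‖ₑ ^ q ≤ C * w n (x - y))
    (hge : ∀ n x y, w n (x - y) ≤ C' * ∑ k, ∑' j, ‖Φ n k j x - Φ n k j y‖ₑ ^ q) :
    costEqRel w K hw ≤ realModEll (ENNReal.ofReal q) := by
  obtain ⟨e⟩ : Nonempty (ℕ ≃ ℕ × κ × ℕ) := nonempty_equiv_of_countable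
  refine ⟨fun (x : ℕ → ℝ) i => Φ (e i).1 (e i).2.1 (e i).2.2 (x (e i).1),
    measurable_pi_lambda _ fun i => (hΦ _ _ _).comp (measurable_pi_apply (X := fun _ => ℝ) (e i).1),
    fun (x y : ℕ → ℝ) => ?_⟩
  refine Iff.trans ?_ (realModEll_rel_iff hq _ _).symm
  change ∑' n, w n (x n - y n) ≠ ∞ ↔ _
  rw [e.tsum_eq fun c : ℕ × κ × ℕ => ‖Φ c.1 c.2.1 c.2.2 (x c.1) - Φ c.1 c.2.1 c.2.2 (y c.1)‖ₑ ^ q,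
    ENNReal.tsum_prod']
  simp only [ENNReal.tsum_prod', tsum_fintype]
  refine ⟨tsum_ne_top_of_le_of_lt_one hC (fun n => hfin n _ _) fun n => hle n _ _, fun h => ?_⟩
  refine ne_top_of_le_ne_top (ENNReal.mul_ne_top hC' h) ?_
  rw [← ENNReal.tsum_mul_left]
  exact ENNReal.tsum_le_tsum fun n => hge n _ _

theorem exists_enorm_rpow_eq {q : ℝ} (hq : 0 < q) {c : ℝ≥0∞} (hc : c ≠ ∞) :
    ∃ A : ℝ, ‖A‖ₑ ^ q = c := by
  refine ⟨(c ^ q⁻¹).toReal, ?_⟩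
  rw [Real.enorm_of_nonneg ENNReal.toReal_nonneg,
    ENNReal.ofReal_toReal (ENNReal.rpow_ne_top_of_nonneg (by positivity) hc),
    ENNReal.rpow_inv_rpow hq.ne']

theorem costEqRel_le_realModEll_of_forall_le {p q : ℝ} (hp : 1 ≤ p) (hpq : p < q) {U : Set ℕ}
    (hU : ∀ t ∈ U, p + exponentGap t ≤ (p + q) / 2) :
    costEqRel (setCost p U) _ (isCost_setCost hp U) ≤ realModEll (ENNReal.ofReal q) := by
  classical
  have hq : 0 < q := by linarith
  let η : ℝ := min 1 ((q - p) / 2)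
  have hη : 0 < η := lt_min one_pos (by linarith)
  have hη1 : η ≤ 1 := min_le_left _ _
  have hη2 : η ≤ (q - p) / 2 := min_le_right _ _
  -- The weights of the two powers of which the cost of the coordinate `n` is composed.
  let a : ℕ → ℝ≥0∞ := fun n => if n.unpair.1 ∈ U then 2⁻¹ ^ n.unpair.1 ^ 2 else 1
  let b : ℕ → ℝ≥0∞ := fun n => if n.unpair.1 ∈ U then 1 else 0
  let s : ℕ → ℝ := fun n => p + exponentGap n.unpair.1
  have hps : ∀ n, p ≤ s n := fun n => le_add_of_nonneg_right (exponentGap_nonneg _)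
  have hcost : ∀ n r, setCost p U n r = a n * trunc r ^ p + b n * trunc r ^ s n := fun n r => by
    by_cases h : n.unpair.1 ∈ U
    · simp [setCost_of_mem h, rowCost, a, b, s, h]
    · simp [setCost_of_notMem h, a, b, h]
  have ha : ∀ n, a n ≠ ∞ := fun n => by
    simp only [a]; split_ifs <;> simp
  have hb : ∀ n, b n ≠ ∞ := fun n => by
    simp only [b]; split_ifs <;> simp
  have hab : ∀ n, 1 ≤ a n + b n := fun n => by
    by_cases h : n.unpair.1 ∈ U <;> simp [a, b, h]
  have hbmul : ∀ n (X Y : ℝ≥0∞), (s n ≤ (p + q) / 2 → X ≤ Y) → b n * X ≤ b n * Y := by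
    intro n X Y h
    by_cases hn : n.unpair.1 ∈ U
    · exact mul_le_mul_right (h (hU _ hn)) _
    · simp [b, hn]
  choose A hA using fun n => exists_enorm_rpow_eq hq (ha n)
  choose B hB using fun n => exists_enorm_rpow_eq hq (hb n)
  let Φ : ℕ → Fin 5 → ℕ → ℝ → ℝ := fun n k j x =>
    ![A n * snowflake Real.cos q p j x, A n * snowflake Real.sin q p j x,
      B n * snowflake Real.cos q (s n) j x, B n * snowflake Real.sin q (s n) j x,
      if j = 0 then x else 0] k
  -- The last sequence separates points at distance more than `1`, where sines and cosines may agree.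
  let cosSum : ℝ → ℝ → ℝ → ℝ≥0∞ := fun s x y =>
    ∑' j, ‖snowflake Real.cos q s j x - snowflake Real.cos q s j y‖ₑ ^ q
  let sinSum : ℝ → ℝ → ℝ → ℝ≥0∞ := fun s x y =>
    ∑' j, ‖snowflake Real.sin q s j x - snowflake Real.sin q s j y‖ₑ ^ q
  have hmul : ∀ (A : ℝ) (f : ℕ → ℝ → ℝ) (x y : ℝ), ∑' j, ‖A * f j x - A * f j y‖ₑ ^ q =
      ‖A‖ₑ ^ q * ∑' j, ‖f j x - f j y‖ₑ ^ q := fun A f x y => by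
    rw [← ENNReal.tsum_mul_left]
    congr 1 with j
    rw [← mul_sub, enorm_mul, ENNReal.mul_rpow_of_nonneg _ _ hq.le]
  have hlast : ∀ x y : ℝ, ∑' j : ℕ, ‖(if j = 0 then x else 0) - (if j = 0 then y else 0)‖ₑ ^ q =
      ‖x - y‖ₑ ^ q := fun x y => by
    rw [tsum_eq_single 0 fun j hj => by simp [hj, hq]]; simp
  have hsum : ∀ n x y, ∑ k, ∑' j, ‖Φ n k j x - Φ n k j y‖ₑ ^ q =
      a n * (cosSum p x y + sinSum p x y) + b n * (cosSum (s n) x y + sinSum (s n) x y) + ‖x - y‖ₑ ^ q := by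
    intro n x y
    rw [Fin.sum_univ_five]
    change ∑' j, ‖A n * snowflake Real.cos q p j x - A n * snowflake Real.cos q p j y‖ₑ ^ q +
      ∑' j, ‖A n * snowflake Real.sin q p j x - A n * snowflake Real.sin q p j y‖ₑ ^ q +
      ∑' j, ‖B n * snowflake Real.cos q (s n) j x - B n * snowflake Real.cos q (s n) j y‖ₑ ^ q +
      ∑' j, ‖B n * snowflake Real.sin q (s n) j x - B n * snowflake Real.sin q (s n) j y‖ₑ ^ q +
      ∑' j : ℕ, ‖(if j = 0 then x else 0) - (if j = 0 then y else 0)‖ₑ ^ q = _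
    rw [hmul, hmul, hmul, hmul, hlast, hA, hB]
    ring
  have hcos2 : ∀ x y, |Real.cos x - Real.cos y| ≤ 2 := fun x y => by
    rw [abs_le]; constructor <;> linarith [Real.cos_le_one x, Real.cos_le_one y,
      Real.neg_one_le_cos x, Real.neg_one_le_cos y]
  have hsin2 : ∀ x y, |Real.sin x - Real.sin y| ≤ 2 := fun x y => by
    rw [abs_le]; constructor <;> linarith [Real.sin_le_one x, Real.sin_le_one y,
      Real.neg_one_le_sin x, Real.neg_one_le_sin y]
  have htrunc : ∀ r : ℝ, |r| ≤ 1 → trunc r = ‖r‖ₑ := fun r hr => by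
    refine min_eq_left ?_
    rwa [← ofReal_norm, ENNReal.ofReal_le_one]
  have hone : ∀ r : ℝ, 1 ≤ |r| → 1 ≤ ‖r‖ₑ := fun r hr => by
    rwa [← ofReal_norm, ENNReal.one_le_ofReal]
  have hupper : ∀ {r x y : ℝ}, |x - y| ≤ 1 → p ≤ r → r ≤ (p + q) / 2 →
      cosSum r x y + sinSum r x y ≤ 2 * snowflakeConst q η * trunc (x - y) ^ r := by
    intro r x y hxy hr hr'
    rw [htrunc _ hxy, mul_assoc, two_mul]
    exact add_le_add
      (tsum_snowflake_le hcos2 Real.abs_cos_sub_cos_le hη (by linarith) (by linarith) hxy)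
      (tsum_snowflake_le hsin2 Real.abs_sin_sub_sin_le hη (by linarith) (by linarith) hxy)
  have hlower : ∀ {r x y : ℝ}, |x - y| ≤ 1 → p ≤ r → r ≤ (p + q) / 2 →
      trunc (x - y) ^ r ≤ ENNReal.ofReal (4 ^ q) * (cosSum r x y + sinSum r x y) := by
    intro r x y hxy hr hr'
    rw [htrunc _ hxy]
    exact le_tsum_snowflake (by linarith) (by linarith) hxy
  refine costEqRel_le_realModEll (isCost_setCost hp U) hq Φ (fun n k j => ?_)
    (C := 2 * snowflakeConst q η + 1) (C' := ENNReal.ofReal (4 ^ q) + 2) ?_ (by finiteness)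
    (fun n x y => ?_) (fun n x y h => ?_) (fun n x y => ?_)
  · have hsnow : ∀ ψ : ℝ → ℝ, Measurable ψ → ∀ r, Measurable (snowflake ψ q r j) := fun ψ hψ r => by
      unfold snowflake
      exact (hψ.comp (measurable_const_mul _)).const_mul _
    have hid : Measurable fun x : ℝ => if j = 0 then x else 0 := by
      by_cases hj : j = 0 <;> simp only [hj, if_true, if_false] <;> fun_prop
    fin_cases k
    · exact (hsnow _ Real.measurable_cos _).const_mul _
    · exact (hsnow _ Real.measurable_sin _).const_mul _
    · exact (hsnow _ Real.measurable_cos _).const_mul _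
    · exact (hsnow _ Real.measurable_sin _).const_mul _
    · exact hid
  · exact ENNReal.add_ne_top.2
      ⟨ENNReal.mul_ne_top (by simp) (snowflakeConst_ne_top hη), ENNReal.one_ne_top⟩
  · rw [hsum]
    have hfin : ∀ r, p ≤ r → cosSum r x y + sinSum r x y ≠ ∞ := fun r hr => ENNReal.add_ne_top.2
      ⟨tsum_snowflake_ne_top hcos2 hq (by linarith) x y,
        tsum_snowflake_ne_top hsin2 hq (by linarith) x y⟩
    exact ENNReal.add_ne_top.2 ⟨ENNReal.add_ne_top.2
      ⟨ENNReal.mul_ne_top (ha n) (hfin p le_rfl), ENNReal.mul_ne_top (hb n) (hfin _ (hps n))⟩,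
      ENNReal.rpow_ne_top_of_nonneg hq.le enorm_ne_top⟩
  · have hxy : |x - y| ≤ 1 := by
      by_contra! hxy
      have h1 : trunc (x - y) = 1 := min_eq_right (hone _ hxy.le)
      rw [hcost, h1, ENNReal.one_rpow, ENNReal.one_rpow, mul_one, mul_one] at h
      exact (hab n).not_gt h
    rw [hsum, hcost]
    have h1 : ‖x - y‖ₑ ^ q ≤ a n * trunc (x - y) ^ p + b n * trunc (x - y) ^ s n := by
      rw [← htrunc _ hxy]
      calc trunc (x - y) ^ q ≤ a n * trunc (x - y) ^ q + b n * trunc (x - y) ^ q := by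
            rw [← add_mul]; exact le_mul_of_one_le_left' (hab n)
        _ ≤ _ := add_le_add (mul_le_mul_right (trunc_rpow_anti hpq.le _) _)
            (hbmul n _ _ fun hn => trunc_rpow_anti (by linarith) _)
    calc _ ≤ a n * (2 * snowflakeConst q η * trunc (x - y) ^ p) +
          b n * (2 * snowflakeConst q η * trunc (x - y) ^ s n) +
          (a n * trunc (x - y) ^ p + b n * trunc (x - y) ^ s n) :=
          add_le_add (add_le_add (mul_le_mul_right (hupper hxy le_rfl (by linarith)) _)
            (hbmul n _ _ fun hn => hupper hxy (hps n) hn)) h1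
      _ = _ := by ring
  · rw [hsum]
    rcases le_or_gt |x - y| 1 with hxy | hxy
    · rw [hcost]
      calc _ ≤ a n * (ENNReal.ofReal (4 ^ q) * (cosSum p x y + sinSum p x y)) +
            b n * (ENNReal.ofReal (4 ^ q) * (cosSum (s n) x y + sinSum (s n) x y)) :=
            add_le_add (mul_le_mul_right (hlower hxy le_rfl (by linarith)) _)
              (hbmul n _ _ fun hn => hlower hxy (hps n) hn)
        _ = ENNReal.ofReal (4 ^ q) *
            (a n * (cosSum p x y + sinSum p x y) + b n * (cosSum (s n) x y + sinSum (s n) x y)) := by ring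
        _ ≤ _ := mul_le_mul' le_self_add le_self_add
    · calc setCost p U n (x - y) ≤ 2 * trunc (x - y) ^ p := setCost_le p U n _
        _ ≤ 2 * ‖x - y‖ₑ ^ q := by
            refine mul_le_mul_right ((ENNReal.rpow_le_one (trunc_le_one _) (by linarith)).trans ?_) _
            exact ENNReal.one_le_rpow (hone _ hxy.le) hq
        _ ≤ _ := mul_le_mul' le_add_self le_add_self

theorem costEqRel_setCost_le_realModEll {p q : ℝ} (hp : 1 ≤ p) (hpq : p < q) (U : Set ℕ) :
    costEqRel (setCost p U) _ (isCost_setCost hp U) ≤ realModEll (ENNReal.ofReal q) := by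
  -- Finitely many rows may be dropped from `U`, and the exponents of the others are small.
  obtain ⟨t₀, ht₀⟩ := eventually_atTop.1
    (tendsto_exponentGap.eventually (Iic_mem_nhds (show 0 < (q - p) / 2 by linarith)))
  have hdrop : AlmostSubset U (U ∩ Set.Ici t₀) :=
    (Set.finite_Iio t₀).subset fun t ht =>
      Set.mem_Iio.2 (not_le.1 fun h => ht.2 ⟨ht.1, h⟩)
  refine (costEqRel_le_of_almostSubset hp hdrop).trans
    (costEqRel_le_realModEll_of_forall_le hp hpq fun t ht => ?_)
  have h1 : exponentGap t ≤ (q - p) / 2 := ht₀ t ht.2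
  linarith

/-! ### The order embedding -/

/-- A map of preorders that preserves and reflects `≤` induces an order embedding of the associated
partial orders. -/
def OrderEmbedding.mapAntisymmetrization {α β : Type*} [Preorder α] [Preorder β] (f : α → β)
    (hf : ∀ a b, f a ≤ f b ↔ a ≤ b) :
    Antisymmetrization α (· ≤ ·) ↪o Antisymmetrization β (· ≤ ·) :=
  OrderEmbedding.ofMapLEIff (OrderHom.antisymmetrization ⟨f, fun a b h => (hf a b).2 h⟩) fun a b => by
    induction a using Antisymmetrization.ind with | _ a
    induction b using Antisymmetrization.ind with | _ b
    exact hf a b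

theorem theorem1 (p : ℝ) (hp : 1 ≤ p) :
    ∃ E : Set ℕ → BorelEqRel,
      (∀ U : Set ℕ, ∀ q : ℝ, p < q →
        realModEll (ENNReal.ofReal p) ≤ E U ∧ E U ≤ realModEll (ENNReal.ofReal q)) ∧
      (∀ U V : Set ℕ, AlmostSubset U V ↔ E U ≤ E V) ∧
      ∃ ι : PowOmegaModFin ↪o BorelDegree,
        (∀ U : Set ℕ, ι (modFin U) = (E U).degree) ∧
        ∀ (a : PowOmegaModFin) (q : ℝ), p < q →
          (realModEll (ENNReal.ofReal p)).degree ≤ ι a ∧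
            ι a ≤ (realModEll (ENNReal.ofReal q)).degree := by
  let E : Set ℕ → BorelEqRel := fun U => costEqRel (setCost p U) _ (isCost_setCost hp U)
  have h1 : ∀ U : Set ℕ, ∀ q : ℝ, p < q →
      realModEll (ENNReal.ofReal p) ≤ E U ∧ E U ≤ realModEll (ENNReal.ofReal q) := fun U q hpq =>
    ⟨realModEll_le_costEqRel hp U, costEqRel_setCost_le_realModEll hp hpq U⟩
  have h2 : ∀ U V : Set ℕ, AlmostSubset U V ↔ E U ≤ E V := fun U V =>
    ⟨costEqRel_le_of_almostSubset hp, almostSubset_of_costEqRel_le hp⟩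
  refine ⟨E, h1, h2, OrderEmbedding.mapAntisymmetrization (α := PowOmega) E
    fun U V => (h2 U V).symm, fun U => rfl, fun a q hpq => ?_⟩
  induction a using Antisymmetrization.ind with | _ U
  exact h1 U q hpq
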